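/- **Setting.** A tracial $\mathrm{W}^*$-algebra $\mathcal M=(M,\tau)$ is a $\mathrm{W}^*$-algebra $M$ with a faithful normal tracial state $\tau$; write $\|x\|_{2}=\tau(x^*x)^{1/2}$, and let $D_r^{\mathcal M}$ be the closed operator-norm ball of radius $r>0$. Terms are built from variables by the $*$-algebra operations (and non-commutative polynomials); basic formulas are $\operatorname{Re}\tau(t)$, $\operatorname{Im}\tau(t)$, $\|s-t\|_2$ for terms $s,t$; formulas are built from these by continuous connectives $\mathbb R^n\to\mathbb R$ and the quantifiers $\sup_{x\in D_r}$, $\inf_{x\in D_r}$. The type $\operatorname{tp}^{\mathcal M}(\mathbf X)$ of $\mathbf X\in M^{\mathbb N}$ is the map $\phi\mapsto\phi^{\mathcal M}(\mathbf X)$ on formulas with free variables $(x_j)_{j\in\mathbb N}$. Let $\mathbb S$ be the set of all types of $\mathbb N$-tuples in tracial $\mathrm{W}^*$-algebras, and for $\mathbf r\in(0,\infty)^{\mathbb N}$ let $\mathbb S_{\mathbf r}\subseteq\mathbb S$ be the set of types of tuples from $\prod_j D_{r_j}$. Give $\mathbb S_{\mathbf r}$ the topology of pointwise convergence on formulas,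 and call $\mathcal O\subseteq\mathbb S$ open if $\mathcal O\cap\mathbb S_{\mathbf r}$ is open in $\mathbb S_{\mathbf r}$ for all $\mathbf r$. A definable predicate is a family of functions $\phi^{\mathcal M}$ of tuples, one for each tracial $\mathrm{W}^*$-algebra $\mathcal M$, such that for every choice of radii for the variables and every $\epsilon>0$ some formula approximates $\phi^{\mathcal M}$ within $\epsilon$ on the corresponding product of balls, for all $\mathcal M$ simultaneously. A definable function $\mathbf f$ is a family of maps $\mathbf f^{\mathcal M}:M^{\mathbb N}\to M^{\mathbb N}$ such that for each $\mathbf r$ there is $\mathbf r'$ with $\mathbf f^{\mathcal M}(\prod_jD_{r_j}^{\mathcal M})\subseteq\prod_jD_{r'_j}^{\mathcal M}$ for all $\mathcal M$, and such that $\phi(\mathbf f(\mathbf x),\tilde{\mathbf x})$ is a definable predicate in $(\mathbf x,\tilde{\mathbf x})$ for every definable predicate $\phi(\mathbf x',\tilde{\mathbf x})$ in two $\mathbb N$-tuples of variables. It induces $\mathbf f_*:\mathbb S\to\mathbb S$, $\mathbf f_*\operatorname{tp}^{\mathcal M}(\mathbf X)=\operatorname{tp}^{\mathcal M}(\mathbf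 f^{\mathcal M}(\mathbf X))$. Fix a non-principal ultrafilter $\mathcal U$ on $\mathbb N$. Give $M_n(\mathbb C)$ its normalized trace. For $\mathcal K\subseteq\mathbb S$ let $\Gamma^{(n)}_{\mathbf r}(\mathcal K)$ be the set of $\mathbf X\in\prod_jD_{r_j}^{M_n(\mathbb C)}$ with $\operatorname{tp}^{M_n(\mathbb C)}(\mathbf X)\in\mathcal K$. For $\Omega\subseteq M_n(\mathbb C)^{\mathbb N}$, finite $F\subseteq\mathbb N$ and $\epsilon>0$, let $K^{\mathrm{orb}}_{F,\epsilon}(\Omega)$ be the least cardinality of a set $\Omega'\subseteq M_n(\mathbb C)^{\mathbb N}$ such that each $\mathbf Y\in\Omega$ admits a unitary $U$ and $\mathbf X\in\Omega'$ with $\|Y_i-UX_iU^*\|_2<\epsilon$ for $i\in F$. Define, in $[-\infty,\infty]$ with $\log 0=-\infty$, $$\operatorname{Ent}^{\mathcal U}_{\mathbf r}(\mathcal K)=\sup_{F,\ \epsilon>0}\ \inf_{\mathcal O\supseteq\mathcal K\text{ open}}\ \lim_{n\to\mathcal U}\frac1{n^2}\log K^{\mathrm{orb}}_{F,\epsilon}\big(\Gamma^{(n)}_{\mathbf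 r}(\mathcal O)\big),\qquad \operatorname{Ent}^{\mathcal U}(\mathcal K)=\sup_{\mathbf r\in(0,\infty)^{\mathbb N}}\operatorname{Ent}^{\mathcal U}_{\mathbf r}(\mathcal K),$$ and $\operatorname{Ent}^{\mathcal U}(\mu)=\operatorname{Ent}^{\mathcal U}(\{\mu\})$ for $\mu\in\mathbb S$. **Theorem.** 1. (Monotonicity under push-forward) Let $\mathbf f$ be a definable function, let $\mathbf r,\mathbf r'\in(0,\infty)^{\mathbb N}$ be such that $\mathbf f^{\mathcal M}$ maps $\prod_jD_{r_j}^{\mathcal M}$ into $\prod_jD_{r'_j}^{\mathcal M}$ for every tracial $\mathrm{W}^*$-algebra $\mathcal M$, and let $\mathcal K\subseteq\mathbb S_{\mathbf r}$ be closed. Then $\operatorname{Ent}^{\mathcal U}_{\mathbf r'}(\mathbf f_*(\mathcal K))\le\operatorname{Ent}^{\mathcal U}_{\mathbf r}(\mathcal K)$. 2. Let $\mathcal M=(M,\tau)$ be a tracial $\mathrm{W}^*$-algebra and $\mathbf X,\mathbf Y\in M^{\mathbb N}$. If $\mathbf Y\in\mathrm W^*(\mathbf X)^{\mathbb N}$,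 where $\mathrm W^*(\mathbf X)$ is the $\mathrm{W}^*$-subalgebra of $M$ generated by $\mathbf X$, then $\operatorname{Ent}^{\mathcal U}(\operatorname{tp}^{\mathcal M}(\mathbf Y))\le\operatorname{Ent}^{\mathcal U}(\operatorname{tp}^{\mathcal M}(\mathbf X))$. 3. In particular, if $\mathrm W^*(\mathbf X)=\mathrm W^*(\mathbf Y)$, then $\operatorname{Ent}^{\mathcal U}(\operatorname{tp}^{\mathcal M}(\mathbf X))=\operatorname{Ent}^{\mathcal U}(\operatorname{tp}^{\mathcal M}(\mathbf Y))$. -/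

import Mathlib

open Set Filter Topology

universe u

namespace TrEnt

noncomputable section

/-! ### The language of tracial W*-algebras -/

/-- Terms of the language of tracial W*-algebras in variables indexed by `V`; `poly p t` is the
symbol attached to the non-commutative polynomial `p`, applied to the terms `t 0, …, t (d - 1)`. -/
inductive TrTerm (V : Type) : Type where
  | var (i : V) : TrTerm V
  | zero : TrTerm V
  | one : TrTerm V
  | add (s t : TrTerm V) : TrTerm V
  | mul (s t : TrTerm V) : TrTerm V
  | adj (t : TrTerm V) : TrTerm V
  | smul (c : ℂ) (t : TrTerm V) : TrTerm V
  | poly {d : ℕ} (p : FreeAlgebra ℂ (Fin d)) (t : Fin d → TrTerm V) : TrTerm V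

/-- Formulas with free variables indexed by `V` together with `k` further variables, indexed by
`Fin k`, that are available to be bound. The basic formulas are `Re tr`, `Im tr` and the metric
applied to terms; the connectives are all continuous functions `ℝⁿ → ℝ`; the quantifiers are
suprema and infima over the domain `D_r`, which bind the last variable of `Fin (k + 1)`.
The formulas in the free variables `V` are the elements of `TrFormula V 0`; each of them
involves only finitely many variables. -/
inductive TrFormula (V : Type) : ℕ → Type where
  | reTr {k : ℕ} (t : TrTerm (V ⊕ Fin k)) : TrFormula V k
  | imTr {k : ℕ} (t : TrTerm (V ⊕ Fin k)) : TrFormula V k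
  | dist {k : ℕ} (s t : TrTerm (V ⊕ Fin k)) : TrFormula V k
  | conn {k n : ℕ} (F : C(Fin n → ℝ, ℝ)) (φ : Fin n → TrFormula V k) : TrFormula V k
  | sup {k : ℕ} (r : Ioi (0 : ℝ)) (φ : TrFormula V (k + 1)) : TrFormula V k
  | inf {k : ℕ} (r : Ioi (0 : ℝ)) (φ : TrFormula V (k + 1)) : TrFormula V k

section Interpretation

variable {M : Type u} [CStarAlgebra M]

/-- The norm `‖x‖₂ = τ(x* x)^{1/2}`. -/
def norm2 (τ : M →ₗ[ℂ] ℂ) (x : M) : ℝ := √(τ (star x * x)).re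

/-- The interpretation of a term. -/
def TrTerm.eval {V : Type} (X : V → M) : TrTerm V → M
  | .var i => X i
  | .zero => 0
  | .one => 1
  | .add s t => s.eval X + t.eval X
  | .mul s t => s.eval X * t.eval X
  | .adj t => star (t.eval X)
  | .smul c t => c • t.eval X
  | .poly p t => FreeAlgebra.lift ℂ (fun i => (t i).eval X) p

/-- The interpretation of a formula at the values `X` of the free variables and the values `W` of
the variables that are available to be bound. The domain `D_r` is interpreted as the ball of
radius `r` for the operator norm. -/
def TrFormula.eval (τ : M →ₗ[ℂ] ℂ) {V : Type} (X : V → M) :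
    {k : ℕ} → TrFormula V k → (Fin k → M) → ℝ
  | _, .reTr t, W => (τ (t.eval (Sum.elim X W))).re
  | _, .imTr t, W => (τ (t.eval (Sum.elim X W))).im
  | _, .dist s t, W => norm2 τ (s.eval (Sum.elim X W) - t.eval (Sum.elim X W))
  | _, .conn F φ, W => F (fun i => (φ i).eval τ X W)
  | k, .sup r φ, W =>
      ⨆ a : {a : M // ‖a‖ ≤ r}, φ.eval τ X (Fin.snoc (α := fun _ : Fin (k + 1) => M) W a.1)
  | k, .inf r φ, W =>
      ⨅ a : {a : M // ‖a‖ ≤ r}, φ.eval τ X (Fin.snoc (α := fun _ : Fin (k + 1) => M) W a.1)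

/-- The value of a formula at a tuple. -/
def TrFormula.val (τ : M →ₗ[ℂ] ℂ) {V : Type} (φ : TrFormula V 0) (X : V → M) : ℝ :=
  φ.eval τ X Fin.elim0

/-- The type of an `ℕ`-tuple: the map that sends a formula to its value at the tuple. -/
def tp (τ : M →ₗ[ℂ] ℂ) (X : ℕ → M) : TrFormula ℕ 0 → ℝ := fun φ => φ.val τ X

end Interpretation

/-! ### Tracial W*-algebras -/

open scoped ComplexOrder in
/-- A tracial W*-algebra: a W*-algebra with a faithful normal tracial state. In `normal'`, the
weak-* topology is the one given by an isometric identification (conjugate-linear, as in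
`WStarAlgebra`) with the dual of a Banach space `P`; it does not depend on that choice. -/
structure TracialWStarAlgebra : Type (u + 1) where
  carrier : Type u
  [cstar : CStarAlgebra carrier]
  [wstar : WStarAlgebra carrier]
  tr : carrier →ₗ[ℂ] ℂ
  nonneg' : ∀ x, 0 ≤ tr (star x * x)
  one' : tr 1 = 1
  mul_comm' : ∀ x y, tr (x * y) = tr (y * x)
  faithful' : ∀ x, tr (star x * x) = 0 → x = 0
  normal' : ∃ (P : Type u) (_ : NormedAddCommGroup P) (_ : NormedSpace ℂ P) (_ : CompleteSpace P)
    (e : StrongDual ℂ P ≃ₗᵢ⋆[ℂ] carrier),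
    Continuous fun φ : WeakDual ℂ P => tr (e (WeakDual.toStrongDual φ))

namespace TracialWStarAlgebra

instance : CoeSort TracialWStarAlgebra.{u} (Type u) := ⟨carrier⟩

variable (M : TracialWStarAlgebra.{u})

instance : CStarAlgebra M := M.cstar
instance : WStarAlgebra M := M.wstar
instance : PartialOrder M := CStarAlgebra.spectralOrder M
instance : StarOrderedRing M := CStarAlgebra.spectralOrderedRing M

open scoped ComplexOrder in
/-- The trace as a positive linear functional. -/
def state : M →ₚ[ℂ] ℂ := PositiveLinearMap.mk₀ M.tr fun x hx => by
  obtain ⟨y, rfl⟩ := CStarAlgebra.nonneg_iff_eq_star_mul_self.mp hx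
  exact M.nonneg' y

/-- The standard representation of `M` on `L²(M, τ)`, with values in the bounded operators with
the strong operator topology. -/
def stdRep (x : M) : M.state.GNS →Lₚₜ[ℂ] M.state.GNS :=
  ContinuousLinearMap.toPointwiseConvergenceCLM ℂ (RingHom.id ℂ) M.state.GNS M.state.GNS
    (M.state.gnsStarAlgHom x)

/-- The W*-subalgebra `W*(X)` of `M` generated by a tuple: the closure of the generated unital
*-subalgebra in the strong operator topology of the standard representation. -/
def wstarGen (X : ℕ → M) : Set M :=
  {y | M.stdRep y ∈ closure (M.stdRep '' (StarAlgebra.adjoin ℂ (range X) : Set M))}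

/-- `∏ⱼ D_{rⱼ}` in `M`. -/
def dom {V : Type} (r : V → Ioi (0 : ℝ)) : Set (V → M) := {X | ∀ j, ‖X j‖ ≤ r j}

end TracialWStarAlgebra

/-! ### The space of types -/

/-- The set of types of tuples from `∏ⱼ D_{rⱼ}` in tracial W*-algebras. -/
def typesIn (r : ℕ → Ioi (0 : ℝ)) : Set (TrFormula ℕ 0 → ℝ) :=
  {μ | ∃ (M : TracialWStarAlgebra.{u}) (X : ℕ → M), X ∈ M.dom r ∧ tp M.tr X = μ}

/-- The space of types of `ℕ`-tuples in tracial W*-algebras. -/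
def TypeSpace : Type :=
  {μ : TrFormula ℕ 0 → ℝ // ∃ (M : TracialWStarAlgebra.{u}) (X : ℕ → M), tp M.tr X = μ}

/-- The inclusion of the types of tuples from `∏ⱼ D_{rⱼ}` in the space of all types. -/
def typesIncl (r : ℕ → Ioi (0 : ℝ)) (μ : typesIn.{u} r) : TypeSpace.{u} :=
  ⟨μ.1, by obtain ⟨M, X, -, h⟩ := μ.2; exact ⟨M, X, h⟩⟩

/-- `𝕊_r`, as a subset of the space of all types. -/
def boundedTypes (r : ℕ → Ioi (0 : ℝ)) : Set TypeSpace.{u} := range (typesIncl.{u} r)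

/-- The logic topology: a set is open if and only if its intersection with each `𝕊_r` is open for
the topology of pointwise convergence on formulas. -/
instance : TopologicalSpace TypeSpace.{u} :=
  ⨆ r : ℕ → Ioi (0 : ℝ), TopologicalSpace.coinduced (typesIncl.{u} r) inferInstance

/-- The type of a tuple in a tracial W*-algebra, as a point of the space of types. -/
def typeOf (M : TracialWStarAlgebra.{u}) (X : ℕ → M) : TypeSpace.{u} := ⟨tp M.tr X, M, X, rfl⟩

/-! ### Definable predicates and definable functions -/

/-- Definable predicates in variables indexed by `V`, relative to the theory of tracial
W*-algebras. -/
def IsDefinablePredicate {V : Type} (φ : (M : TracialWStarAlgebra.{u}) → (V → M) → ℝ) : Prop :=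
  ∀ (r : V → Ioi (0 : ℝ)) (ε : ℝ), 0 < ε → ∃ ψ : TrFormula V 0,
    ∀ (M : TracialWStarAlgebra.{u}) (X : V → M), X ∈ M.dom r → |φ M X - ψ.val M.tr X| < ε

/-- Definable functions from `ℕ`-tuples to `ℕ`-tuples, relative to the theory of tracial
W*-algebras. In `definable'`, the left summand of `ℕ ⊕ ℕ` indexes the variables into which the
function is substituted and the right summand the additional variables. -/
structure DefinableFunction : Type (u + 1) where
  toFun : (M : TracialWStarAlgebra.{u}) → (ℕ → M) → (ℕ → M)
  bounded' : ∀ r : ℕ → Ioi (0 : ℝ), ∃ r' : ℕ → Ioi (0 : ℝ),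
    ∀ M : TracialWStarAlgebra.{u}, MapsTo (toFun M) (M.dom r) (M.dom r')
  definable' : ∀ φ : (M : TracialWStarAlgebra.{u}) → (ℕ ⊕ ℕ → M) → ℝ, IsDefinablePredicate φ →
    IsDefinablePredicate fun (M : TracialWStarAlgebra.{u}) (Z : ℕ ⊕ ℕ → M) =>
      φ M (Sum.elim (toFun M (Z ∘ Sum.inl)) (Z ∘ Sum.inr))

instance : CoeFun DefinableFunction.{u}
    (fun _ => (M : TracialWStarAlgebra.{u}) → (ℕ → M) → (ℕ → M)) := ⟨DefinableFunction.toFun⟩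

/-- Renaming of variables in a term. -/
def TrTerm.rename {V W : Type} (g : V → W) : TrTerm V → TrTerm W
  | .var i => .var (g i)
  | .zero => .zero
  | .one => .one
  | .add s t => .add (s.rename g) (t.rename g)
  | .mul s t => .mul (s.rename g) (t.rename g)
  | .adj t => .adj (t.rename g)
  | .smul c t => .smul c (t.rename g)
  | .poly p t => .poly p (fun i => (t i).rename g)

/-- Renaming of the free variables of a formula. -/
def TrFormula.rename {V W : Type} (g : V → W) : {k : ℕ} → TrFormula V k → TrFormula W k
  | _, .reTr t => .reTr (t.rename (Sum.map g id))
  | _, .imTr t => .imTr (t.rename (Sum.map g id))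
  | _, .dist s t => .dist (s.rename (Sum.map g id)) (t.rename (Sum.map g id))
  | _, .conn F φ => .conn F (fun i => (φ i).rename g)
  | _, .sup r φ => .sup r (φ.rename g)
  | _, .inf r φ => .inf r (φ.rename g)

theorem TrTerm.eval_rename {M : Type u} [CStarAlgebra M] {V W : Type} (g : V → W) (X : W → M)
    (t : TrTerm V) : (t.rename g).eval X = t.eval (X ∘ g) := by
  induction t <;> simp_all [TrTerm.rename, TrTerm.eval]

theorem TrFormula.eval_rename {M : Type u} [CStarAlgebra M] (τ : M →ₗ[ℂ] ℂ) {V W : Type}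
    (g : V → W) (X : W → M) {k : ℕ} (φ : TrFormula V k) (Y : Fin k → M) :
    (φ.rename g).eval τ X Y = φ.eval τ (X ∘ g) Y := by
  have h : ∀ {k : ℕ} (Y : Fin k → M),
      Sum.elim X Y ∘ Sum.map g id = Sum.elim (X ∘ g) Y := fun Y => by
    ext i; cases i <;> rfl
  induction φ <;> simp_all [TrFormula.rename, TrFormula.eval, TrTerm.eval_rename]

/-- The type of `f(X)` depends only on the type of `X`. -/
theorem DefinableFunction.typeOf_congr (f : DefinableFunction.{u}) {M N : TracialWStarAlgebra.{u}}
    {X : ℕ → M} {Y : ℕ → N} (h : tp M.tr X = tp N.tr Y) :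
    tp M.tr (f M X) = tp N.tr (f N Y) := by
  funext φ
  have hP : IsDefinablePredicate fun (M : TracialWStarAlgebra.{u}) (Z : ℕ ⊕ ℕ → M) =>
      φ.val M.tr (Z ∘ Sum.inl) := fun r ε hε =>
    ⟨φ.rename Sum.inl, fun M Z _ => by simpa [TrFormula.val, TrFormula.eval_rename] using hε⟩
  have hQ := f.definable' _ hP
  let r : ℕ → Ioi (0 : ℝ) := fun j => ⟨‖X j‖ + ‖Y j‖ + 1, by simp only [mem_Ioi]; positivity⟩
  refine eq_of_forall_dist_le fun ε hε => ?_
  obtain ⟨ψ, hψ⟩ := hQ (Sum.elim r r) (ε / 2) (half_pos hε)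
  have hX := hψ M (Sum.elim X X) (by
    rintro (j | j) <;> simp only [Sum.elim_inl, Sum.elim_inr, r] <;>
      linarith [norm_nonneg (Y j)])
  have hY := hψ N (Sum.elim Y Y) (by
    rintro (j | j) <;> simp only [Sum.elim_inl, Sum.elim_inr, r] <;>
      linarith [norm_nonneg (X j)])
  have e : ∀ (K : TracialWStarAlgebra.{u}) (Z : ℕ → K),
      ψ.val K.tr (Sum.elim Z Z) = tp K.tr Z (ψ.rename (Sum.elim id id)) := fun K Z => by
    have : Sum.elim Z Z = Z ∘ Sum.elim id id := by ext i; cases i <;> rfl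
    simp only [tp, TrFormula.val, TrFormula.eval_rename, this]
  rw [e] at hX hY
  rw [h] at hX
  simp only [Sum.elim_comp_inl] at hX hY
  rw [Real.dist_eq, abs_le]
  simp only [tp] at *
  rw [abs_lt] at hX hY
  constructor <;> linarith [hX.1, hX.2, hY.1, hY.2]

/-- The push-forward `f_*` on the space of types, which satisfies
`f_* (tp X) = tp (f(X))` (see `DefinableFunction.pushforward_typeOf`). -/
def DefinableFunction.pushforward (f : DefinableFunction.{u}) (μ : TypeSpace.{u}) :
    TypeSpace.{u} :=
  typeOf μ.2.choose (f μ.2.choose μ.2.choose_spec.choose)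

theorem DefinableFunction.pushforward_typeOf (f : DefinableFunction.{u})
    (M : TracialWStarAlgebra.{u}) (X : ℕ → M) :
    f.pushforward (typeOf M X) = typeOf M (f M X) :=
  Subtype.ext (f.typeOf_congr (typeOf M X).2.choose_spec.choose_spec)

/-! ### Covering entropy -/

section Entropy

open scoped Matrix.Norms.L2Operator

/-- `M_n(ℂ)`, with the operator norm. -/
abbrev Mat (n : ℕ) : Type := Matrix (Fin n) (Fin n) ℂ

/-- The normalized trace of `M_n(ℂ)`. -/
def ntr (n : ℕ) : Mat n →ₗ[ℂ] ℂ := (n : ℂ)⁻¹ • Matrix.traceLinearMap (Fin n) ℂ ℂ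

/-- The microstate space `Γ_r^{(n)}(K)`. -/
def microstates (r : ℕ → Ioi (0 : ℝ)) (n : ℕ) (K : Set TypeSpace.{u}) : Set (ℕ → Mat n) :=
  {X | (∀ j, ‖X j‖ ≤ r j) ∧ ∃ μ ∈ K, μ.1 = tp (ntr n) X}

/-- The orbital `(F, ε)`-neighbourhood of a set of tuples of matrices. -/
def orbNhd {n : ℕ} (F : Finset ℕ) (ε : ℝ) (Ω : Set (ℕ → Mat n)) : Set (ℕ → Mat n) :=
  {Y | ∃ V ∈ Matrix.unitaryGroup (Fin n) ℂ, ∃ X ∈ Ω,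
    ∀ i ∈ F, norm2 (ntr n) (Y i - V * X i * star V) < ε}

/-- The orbital covering number: the minimum cardinality of a set that orbitally
`(F, ε)`-covers `Ω`. -/
def orbCov {n : ℕ} (F : Finset ℕ) (ε : ℝ) (Ω : Set (ℕ → Mat n)) : ℕ∞ :=
  ⨅ (Ω' : Set (ℕ → Mat n)) (_ : Ω ⊆ orbNhd F ε Ω'), Ω'.encard

/-- The limit along an ultrafilter of a sequence in `[-∞, ∞]`. -/
def ulim (U : Ultrafilter ℕ) (a : ℕ → EReal) : EReal := limUnder (U : Filter ℕ) a

theorem tendsto_ulim (U : Ultrafilter ℕ) (a : ℕ → EReal) :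
    Tendsto a (U : Filter ℕ) (𝓝 (ulim U a)) := by
  obtain ⟨l, -, hl⟩ := isCompact_univ.ultrafilter_le_nhds (U.map a) (by simp)
  exact tendsto_nhds_limUnder ⟨l, hl⟩

/-- `Ent_{r,F,ε}^U(K)`. -/
def entAt (U : Ultrafilter ℕ) (r : ℕ → Ioi (0 : ℝ)) (F : Finset ℕ) (ε : ℝ)
    (K : Set TypeSpace.{u}) : EReal :=
  ⨅ (O : Set TypeSpace.{u}) (_ : IsOpen O) (_ : K ⊆ O),
    ulim U fun n =>
      ((1 / (n : ℝ) ^ 2 : ℝ) : EReal) * ENNReal.log ((orbCov F ε (microstates r n O) : ℕ∞))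

/-- `Ent_r^U(K)`. -/
def entBdd (U : Ultrafilter ℕ) (r : ℕ → Ioi (0 : ℝ)) (K : Set TypeSpace.{u}) : EReal :=
  ⨆ (F : Finset ℕ) (ε : ℝ) (_ : 0 < ε), entAt U r F ε K

/-- The covering entropy `Ent^U(K)` of a set of types. -/
def ent (U : Ultrafilter ℕ) (K : Set TypeSpace.{u}) : EReal :=
  ⨆ r : ℕ → Ioi (0 : ℝ), entBdd U r K

/-- The covering entropy `Ent^U(μ)` of a type. -/
def entType (U : Ultrafilter ℕ) (μ : TypeSpace.{u}) : EReal := ent U {μ}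

end Entropy

end

end TrEnt

open TrEnt

namespace TrEnt

noncomputable section

/-! ### The 2-norm -/

section TwoNorm

variable (M : TracialWStarAlgebra.{u})

/-! Both inequalities come from `entBdd_le_of_formula`. Its input is one formula `ψ(x, y)` that
relates the tuples of `K` to those of `K'` and is rigid: `ψ < 2c` determines finitely many entries
of `y` from `x` up to `ε` in 2-norm. For push-forwards `ψ` approximates `∑ ‖f(x)ᵢ - yᵢ‖₂`. For `Y`
in `W*(X)` it is `∑ ‖tᵢ(x) - yᵢ‖₂`, with terms `tᵢ(X)` close to `Yᵢ`.

Formulas with quantifiers carry the relation to matrices. If a sublevel set `θ < c` lies in the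
neighbourhood `O` of `K`, then `χ(y) = inf_x max(ψ(x, y), θ(x))` is again a formula
(`TrFormula.exists_inf_left`). A matrix tuple `Y` with `χ(Y) < c` therefore has a partner `X` in the
same `M_n(ℂ)`, a microstate for `O` with `ψ(X, Y) < c`.

Formulas are uniformly continuous in 2-norm, with a modulus independent of the algebra
(`TrFormula.uniform_bound_continuity`), and invariant under joint unitary conjugation
(`TrFormula.val_starAlgEquiv`). So if `X` is close to `V X' V*`, then `ψ(X, V Y' V*) < 2c`, and
rigidity makes `Y` close to `V Y' V*`. An orbital cover of the partners thus yields one of the `Y`'s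
of no larger size (`orbCov_le_of_relation`). -/

theorem norm2_eq_norm_toPreGNS (x : M) : norm2 M.tr x = ‖M.state.toPreGNS x‖ := rfl

theorem norm2_nonneg (x : M) : 0 ≤ norm2 M.tr x := Real.sqrt_nonneg _

theorem norm2_zero : norm2 M.tr (0 : M) = 0 := by simp [norm2]

theorem norm2_add_le (x y : M) : norm2 M.tr (x + y) ≤ norm2 M.tr x + norm2 M.tr y := by
  simp only [norm2_eq_norm_toPreGNS, map_add]
  exact norm_add_le _ _

theorem norm2_sub_comm (x y : M) : norm2 M.tr (x - y) = norm2 M.tr (y - x) := by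
  simp only [norm2_eq_norm_toPreGNS, map_sub]
  exact norm_sub_rev _ _

theorem norm2_sub_le (x y z : M) :
    norm2 M.tr (x - z) ≤ norm2 M.tr (x - y) + norm2 M.tr (y - z) := by
  simp only [norm2_eq_norm_toPreGNS, map_sub]
  exact norm_sub_le_norm_sub_add_norm_sub _ _ _

theorem norm2_star (x : M) : norm2 M.tr (star x) = norm2 M.tr x := by
  simp only [norm2, star_star, M.mul_comm' x]

theorem norm2_mul_le_left (x y : M) : norm2 M.tr (x * y) ≤ ‖x‖ * norm2 M.tr y := by
  have h := (M.state.leftMulMapPreGNS x).le_of_opNorm_le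
    (LinearMap.mkContinuous_norm_le _ (norm_nonneg x) _) (M.state.toPreGNS y)
  simpa [norm2_eq_norm_toPreGNS] using h

/-- Traciality makes the adjoint isometric for the 2-norm, so right multiplication inherits the
bound for left multiplication. This two-sidedness is what makes products Lipschitz on operator-norm
balls. -/
theorem norm2_mul_le_right (x y : M) : norm2 M.tr (x * y) ≤ norm2 M.tr x * ‖y‖ := by
  have h := norm2_mul_le_left M (star y) (star x)
  rwa [← star_mul, norm2_star, norm2_star, norm_star, mul_comm] at h

theorem norm2_one : norm2 M.tr (1 : M) = 1 := by simp [norm2, M.one']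

theorem norm2_le_norm (x : M) : norm2 M.tr x ≤ ‖x‖ := by
  simpa [norm2_one] using norm2_mul_le_left M x 1

/-- Cauchy–Schwarz against the unit vector `1`. -/
theorem norm_tr_le_norm2 (x : M) : ‖M.tr x‖ ≤ norm2 M.tr x := by
  have h := norm_inner_le_norm (𝕜 := ℂ) (M.state.toPreGNS 1) (M.state.toPreGNS x)
  rw [PositiveLinearMap.preGNS_inner_def, ← norm2_eq_norm_toPreGNS, ← norm2_eq_norm_toPreGNS,
    norm2_one, one_mul] at h
  simp only [PositiveLinearMap.ofPreGNS_toPreGNS, star_one, one_mul] at h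
  exact h

end TwoNorm

/-! ### Uniform continuity of terms and formulas -/

section UniformContinuity

variable {V : Type}

/-- Families of functions that are bounded in operator norm and Lipschitz in the 2-norm on products
of balls, with constants that do not depend on the algebra, and that depend only on finitely many
variables. -/
def IsUniformlyLipschitz (a : (M : TracialWStarAlgebra.{u}) → (V → M) → M) : Prop :=
  ∃ F : Finset V, ∀ r : V → Ioi (0 : ℝ), ∃ C : ℝ, 0 ≤ C ∧
    ∀ (M : TracialWStarAlgebra.{u}) (X X' : V → M), X ∈ M.dom r → X' ∈ M.dom r →
      ‖a M X‖ ≤ C ∧ ∀ d : ℝ, 0 ≤ d → (∀ i ∈ F, norm2 M.tr (X i - X' i) ≤ d) →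
        norm2 M.tr (a M X - a M X') ≤ C * d

namespace IsUniformlyLipschitz

variable {a b : (M : TracialWStarAlgebra.{u}) → (V → M) → M}

theorem var (i : V) : IsUniformlyLipschitz.{u} fun _ (X : V → _) => X i := by
  refine ⟨{i}, fun r => ⟨max (r i) 1, by positivity, fun M X X' hX _ => ⟨?_, fun d hd h => ?_⟩⟩⟩
  · exact (hX i).trans (le_max_left _ _)
  · calc _ ≤ 1 * d := by simpa using h i (by simp)
      _ ≤ _ := by gcongr; exact le_max_right _ _

theorem const (c : ℂ) : IsUniformlyLipschitz (V := V) fun (M : TracialWStarAlgebra.{u}) _ =>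
    c • (1 : M) := by
  refine ⟨∅, fun r => ⟨‖c‖, norm_nonneg _, fun M X X' _ _ => ⟨?_, fun d hd h => ?_⟩⟩⟩
  · rw [norm_smul]
    have : ‖(1 : M)‖ ≤ 1 := by
      rcases subsingleton_or_nontrivial M with h | h
      · simp [Subsingleton.elim (1 : M) 0]
      · exact CStarRing.norm_one.le
    simpa using mul_le_mul_of_nonneg_left this (norm_nonneg c)
  · rw [sub_self, norm2_zero]; positivity

theorem add (ha : IsUniformlyLipschitz a) (hb : IsUniformlyLipschitz b) :
    IsUniformlyLipschitz fun M X => a M X + b M X := by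
  classical
  obtain ⟨F, hF⟩ := ha
  obtain ⟨G, hG⟩ := hb
  refine ⟨F ∪ G, fun r => ?_⟩
  obtain ⟨C, hC, h⟩ := hF r
  obtain ⟨D, hD, h'⟩ := hG r
  refine ⟨C + D, by positivity, fun M X X' hX hX' => ⟨?_, fun d hd hi => ?_⟩⟩
  · exact norm_add_le_of_le (h M X X' hX hX').1 (h' M X X' hX hX').1
  · have h1 := (h M X X' hX hX').2 d hd fun i hi' => hi i (by simp [hi'])
    have h2 := (h' M X X' hX hX').2 d hd fun i hi' => hi i (by simp [hi'])
    rw [add_sub_add_comm, add_mul]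
    exact (norm2_add_le M _ _).trans (add_le_add h1 h2)

theorem mul (ha : IsUniformlyLipschitz a) (hb : IsUniformlyLipschitz b) :
    IsUniformlyLipschitz fun M X => a M X * b M X := by
  classical
  obtain ⟨F, hF⟩ := ha
  obtain ⟨G, hG⟩ := hb
  refine ⟨F ∪ G, fun r => ?_⟩
  obtain ⟨C, hC, h⟩ := hF r
  obtain ⟨D, hD, h'⟩ := hG r
  -- In `ab - a'b' = a(b - b') + (a - a')b'` each summand has 2-norm at most `C * D * d`.
  refine ⟨2 * C * D, by positivity, fun M X X' hX hX' => ⟨?_, fun d hd hi => ?_⟩⟩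
  · have := mul_le_mul (h M X X' hX hX').1 (h' M X X' hX hX').1 (norm_nonneg _) hC
    exact (norm_mul_le _ _).trans (this.trans (by nlinarith [mul_nonneg hC hD]))
  · have h1 := (h M X X' hX hX').2 d hd fun i hi' => hi i (by simp [hi'])
    have h2 := (h' M X X' hX hX').2 d hd fun i hi' => hi i (by simp [hi'])
    have e : a M X * b M X - a M X' * b M X' =
        a M X * (b M X - b M X') + (a M X - a M X') * b M X' := by noncomm_ring
    rw [e]
    refine (norm2_add_le M _ _).trans ?_
    have h3 := (norm2_mul_le_left M (a M X) (b M X - b M X')).trans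
      (mul_le_mul (h M X X' hX hX').1 h2 (norm2_nonneg M _) hC)
    have h4 := (norm2_mul_le_right M (a M X - a M X') (b M X')).trans
      (mul_le_mul h1 (h' M X' X hX' hX).1 (norm_nonneg _) (by positivity))
    calc _ ≤ _ := add_le_add h3 h4
      _ = _ := by ring

theorem star (ha : IsUniformlyLipschitz a) : IsUniformlyLipschitz fun M X => star (a M X) := by
  obtain ⟨F, hF⟩ := ha
  refine ⟨F, fun r => ?_⟩
  obtain ⟨C, hC, h⟩ := hF r
  refine ⟨C, hC, fun M X X' hX hX' => ?_⟩
  simpa only [← star_sub, norm2_star, norm_star] using h M X X' hX hX'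

end IsUniformlyLipschitz

theorem TrTerm.isUniformlyLipschitz (t : TrTerm V) :
    IsUniformlyLipschitz.{u} fun _ X => t.eval X := by
  induction t with
  | var i => exact .var i
  | zero => simpa [TrTerm.eval] using IsUniformlyLipschitz.const.{u} (V := V) 0
  | one => simpa [TrTerm.eval] using IsUniformlyLipschitz.const.{u} (V := V) 1
  | add s t hs ht => exact hs.add ht
  | mul s t hs ht => exact hs.mul ht
  | adj t ht => exact ht.star
  | smul c t ht => simpa [TrTerm.eval] using (IsUniformlyLipschitz.const c).mul ht
  | poly p t ht =>
    simp only [TrTerm.eval]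
    induction p using FreeAlgebra.induction with
    | grade0 c =>
      simpa [AlgHom.commutes, Algebra.algebraMap_eq_smul_one] using
        IsUniformlyLipschitz.const.{u} (V := V) c
    | grade1 i => simpa using ht i
    | mul p q hp hq => simpa using hp.mul hq
    | add p q hp hq => simpa using hp.add hq

/-- The data of a uniform modulus of continuity and a uniform bound for a formula. -/
theorem TrFormula.uniform_bound_continuity {k : ℕ} (φ : TrFormula V k) :
    ∃ F : Finset V, ∀ (r : V → Ioi (0 : ℝ)) (s : Fin k → Ioi (0 : ℝ)),
      (∃ C : ℝ, ∀ (M : TracialWStarAlgebra.{u}) (X : V → M) (W : Fin k → M),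
        X ∈ M.dom r → W ∈ M.dom s → |φ.eval M.tr X W| ≤ C) ∧
      ∀ ε : ℝ, 0 < ε → ∀ᶠ δ in 𝓝[>] (0 : ℝ),
        ∀ (M : TracialWStarAlgebra.{u}) (X X' : V → M) (W W' : Fin k → M),
        X ∈ M.dom r → X' ∈ M.dom r → W ∈ M.dom s → W' ∈ M.dom s →
        (∀ i ∈ F, norm2 M.tr (X i - X' i) ≤ δ) → (∀ j, norm2 M.tr (W j - W' j) ≤ δ) →
        |φ.eval M.tr X W - φ.eval M.tr X' W'| ≤ ε := by
  classical
  -- Moduli are stated as eventual properties of `δ → 0⁺`, so that finitely many requirements on `δ`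
  -- combine by intersecting filters.
  have small : ∀ C ε : ℝ, 0 < ε → ∀ᶠ δ in 𝓝[>] (0 : ℝ), 0 ≤ δ ∧ C * δ ≤ ε := fun C ε hε => by
    have h1 : Tendsto (fun δ : ℝ => C * δ) (𝓝[>] 0) (𝓝 0) := by
      have : Continuous fun δ : ℝ => C * δ := by fun_prop
      simpa using (this.tendsto 0).mono_left nhdsWithin_le_nhds
    filter_upwards [h1.eventually_le_const hε, self_mem_nhdsWithin] with δ h2 h3
    exact ⟨le_of_lt h3, h2⟩
  have elim_dom : ∀ {k : ℕ} {r : V → Ioi (0 : ℝ)} {s : Fin k → Ioi (0 : ℝ)}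
      {M : TracialWStarAlgebra.{u}} {X : V → M} {W : Fin k → M}, X ∈ M.dom r → W ∈ M.dom s →
      Sum.elim X W ∈ M.dom (Sum.elim r s) := by
    rintro k r s M X W hX hW (i | i)
    exacts [hX i, hW i]
  have elim_close : ∀ {k : ℕ} {F : Finset (V ⊕ Fin k)} {G : Finset V}
      {M : TracialWStarAlgebra.{u}} {X X' : V → M} {W W' : Fin k → M} {δ : ℝ}, F.toLeft ⊆ G →
      (∀ i ∈ G, norm2 M.tr (X i - X' i) ≤ δ) → (∀ j, norm2 M.tr (W j - W' j) ≤ δ) →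
      ∀ i ∈ F, norm2 M.tr (Sum.elim X W i - Sum.elim X' W' i) ≤ δ := by
    rintro k F G M X X' W W' δ hFG h1 h2 (i | i) hi
    · exact h1 i (hFG (by simpa using hi))
    · exact h2 i
  -- Real and imaginary parts are treated together, as contractive real-linear functionals `ρ` of
  -- the trace.
  have tr_case : ∀ {k : ℕ} (ρ : ℂ →L[ℝ] ℝ) (t : TrTerm (V ⊕ Fin k)), ‖ρ‖ ≤ 1 →
      ∃ F : Finset V, ∀ (r : V → Ioi (0 : ℝ)) (s : Fin k → Ioi (0 : ℝ)),
      (∃ C : ℝ, ∀ (M : TracialWStarAlgebra.{u}) (X : V → M) (W : Fin k → M),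
        X ∈ M.dom r → W ∈ M.dom s → |ρ (M.tr (t.eval (Sum.elim X W)))| ≤ C) ∧
      ∀ ε : ℝ, 0 < ε → ∀ᶠ δ in 𝓝[>] (0 : ℝ),
        ∀ (M : TracialWStarAlgebra.{u}) (X X' : V → M) (W W' : Fin k → M),
        X ∈ M.dom r → X' ∈ M.dom r → W ∈ M.dom s → W' ∈ M.dom s →
        (∀ i ∈ F, norm2 M.tr (X i - X' i) ≤ δ) → (∀ j, norm2 M.tr (W j - W' j) ≤ δ) →
        |ρ (M.tr (t.eval (Sum.elim X W))) - ρ (M.tr (t.eval (Sum.elim X' W')))| ≤ ε := by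
    intro k ρ t hρ
    have hρ' : ∀ (M : TracialWStarAlgebra.{u}) (x : M), |ρ (M.tr x)| ≤ norm2 M.tr x := fun M x => by
      have := (ρ.le_of_opNorm_le hρ (M.tr x)).trans (by simpa using norm_tr_le_norm2 M x)
      simpa using this
    obtain ⟨F, hF⟩ := t.isUniformlyLipschitz
    refine ⟨F.toLeft, fun r s => ?_⟩
    obtain ⟨C, hC, h⟩ := hF (Sum.elim r s)
    refine ⟨⟨C, fun M X W hX hW => ?_⟩, fun ε hε => ?_⟩
    · exact (hρ' M _).trans ((norm2_le_norm M _).trans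
        (h M _ _ (elim_dom hX hW) (elim_dom hX hW)).1)
    · filter_upwards [small C ε hε] with δ hδ M X X' W W' hX hX' hW hW' h1 h2
      rw [← map_sub, ← map_sub]
      exact (hρ' M _).trans (((h M _ _ (elim_dom hX hW) (elim_dom hX' hW')).2 δ hδ.1
        (elim_close subset_rfl h1 h2)).trans hδ.2)
  have snoc_dom : ∀ {k : ℕ} {s : Fin k → Ioi (0 : ℝ)} {ρ : Ioi (0 : ℝ)}
      {M : TracialWStarAlgebra.{u}} {W : Fin k → M}, W ∈ M.dom s → ∀ a : {a : M // ‖a‖ ≤ ρ},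
      (Fin.snoc (α := fun _ : Fin (k + 1) => (M : Type u)) W a.1) ∈
        M.dom (Fin.snoc (α := fun _ : Fin (k + 1) => Ioi (0 : ℝ)) s ρ) := by
    intro k s ρ M W hW a j
    refine Fin.lastCases ?_ (fun j => ?_) j
    · simpa using a.2
    · simpa using hW j
  have snoc_close : ∀ {k : ℕ} {M : TracialWStarAlgebra.{u}} {W W' : Fin k → M} {δ : ℝ}, 0 ≤ δ →
      (∀ j, norm2 M.tr (W j - W' j) ≤ δ) → ∀ (a : M) (j : Fin (k + 1)), norm2 M.tr
      (Fin.snoc (α := fun _ : Fin (k + 1) => (M : Type u)) W a j -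
        Fin.snoc (α := fun _ : Fin (k + 1) => (M : Type u)) W' a j) ≤ δ := by
    intro k M W W' δ hδ h a j
    refine Fin.lastCases ?_ (fun j => ?_) j
    · simpa [norm2_zero] using hδ
    · simpa using h j
  have pos : ∀ᶠ δ in 𝓝[>] (0 : ℝ), 0 ≤ δ := by
    filter_upwards [self_mem_nhdsWithin] with δ h using le_of_lt h
  induction φ with
  | reTr t =>
    exact tr_case Complex.reCLM t Complex.reCLM_norm.le
  | imTr t =>
    exact tr_case Complex.imCLM t Complex.imCLM_norm.le
  | dist s t =>
    obtain ⟨F, hF⟩ := (s.isUniformlyLipschitz.add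
      ((IsUniformlyLipschitz.const (-1)).mul t.isUniformlyLipschitz))
    refine ⟨F.toLeft, fun r s' => ?_⟩
    obtain ⟨C, hC, h⟩ := hF (Sum.elim r s')
    simp only [neg_smul, one_smul, neg_mul, one_mul, ← sub_eq_add_neg] at h
    refine ⟨⟨C, fun M X W hX hW => ?_⟩, fun ε hε => ?_⟩
    · simp only [TrFormula.eval]
      rw [abs_of_nonneg (norm2_nonneg M _)]
      exact (norm2_le_norm M _).trans (h M _ _ (elim_dom hX hW) (elim_dom hX hW)).1
    · filter_upwards [small C ε hε] with δ hδ M X X' W W' hX hX' hW hW' h1 h2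
      simp only [TrFormula.eval]
      refine le_trans ?_ (((h M _ _ (elim_dom hX hW) (elim_dom hX' hW')).2 δ hδ.1
        (elim_close subset_rfl h1 h2)).trans hδ.2)
      simp only [norm2_eq_norm_toPreGNS]
      rw [map_sub M.state.toPreGNS (_ - _)]
      exact abs_norm_sub_norm_le _ _
  | @conn k n G φ ih =>
    choose F hF using ih
    refine ⟨Finset.univ.biUnion F, fun r s => ?_⟩
    choose C hC using fun i => (hF i r s).1
    have hC' : ∀ (M : TracialWStarAlgebra.{u}) (X : V → M) (W : Fin k → M), X ∈ M.dom r →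
        W ∈ M.dom s → (fun i => (φ i).eval M.tr X W) ∈ Icc (fun i => -C i) C :=
      fun M X W hX hW => ⟨fun i => (abs_le.1 (hC i M X W hX hW)).1,
        fun i => (abs_le.1 (hC i M X W hX hW)).2⟩
    -- A connective need not be uniformly continuous on all of `ℝⁿ`; it is on the compact box
    -- containing the values of the subformulas. This is why bounds and moduli are proved in one
    -- induction.
    have hK : IsCompact (Icc (fun i => -C i) C) := isCompact_Icc
    refine ⟨?_, fun ε hε => ?_⟩
    · obtain ⟨D, hD⟩ := hK.exists_bound_of_continuousOn G.continuous.continuousOn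
      exact ⟨D, fun M X W hX hW => hD _ (hC' M X W hX hW)⟩
    · obtain ⟨η, hη, h⟩ := Metric.uniformContinuousOn_iff_le.1
        (hK.uniformContinuousOn_of_continuous G.continuous.continuousOn) ε hε
      have hev := eventually_all.2 fun i => (hF i r s).2 η hη
      filter_upwards [hev] with δ hδ M X X' W W' hX hX' hW hW' h1 h2
      refine h _ (hC' M X W hX hW) _ (hC' M X' W' hX' hW') ((dist_pi_le_iff hη.le).2 fun i => ?_)
      exact hδ i M X X' W W' hX hX' hW hW'
        (fun j hj => h1 j (Finset.mem_biUnion.2 ⟨i, Finset.mem_univ i, hj⟩)) h2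
  | @sup k ρ φ ih =>
    obtain ⟨F, hF⟩ := ih
    refine ⟨F, fun r s => ?_⟩
    obtain ⟨⟨C, hC⟩, hF⟩ := hF r (Fin.snoc (α := fun _ : Fin (k + 1) => Ioi (0 : ℝ)) s ρ)
    have hne : ∀ M : TracialWStarAlgebra.{u}, Nonempty {a : M // ‖a‖ ≤ ρ} := fun M =>
      ⟨⟨0, by simpa using ρ.2.le⟩⟩
    -- A real `⨆` has its intended meaning only for families bounded above; the inductive bound
    -- supplies this.
    have hbdd : ∀ (M : TracialWStarAlgebra.{u}) (X : V → M) (W : Fin k → M), X ∈ M.dom r →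
        W ∈ M.dom s → BddAbove (range fun a : {a : M // ‖a‖ ≤ ρ} => φ.eval M.tr X
          (Fin.snoc (α := fun _ : Fin (k + 1) => (M : Type u)) W a.1)) := fun M X W hX hW =>
      ⟨C, by rintro _ ⟨a, rfl⟩; exact (abs_le.1 (hC M X _ hX (snoc_dom hW a))).2⟩
    refine ⟨⟨C, fun M X W hX hW => ?_⟩, fun ε hε => ?_⟩
    · have := hne M
      refine abs_le.2 ⟨?_, ciSup_le fun a => (abs_le.1 (hC M X _ hX (snoc_dom hW a))).2⟩
      exact le_ciSup_of_le (hbdd M X W hX hW) (Classical.arbitrary _)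
        (abs_le.1 (hC M X _ hX (snoc_dom hW _))).1
    · filter_upwards [hF ε hε, pos] with δ hδ hpos M X X' W W' hX hX' hW hW' h1 h2
      have := hne M
      have key : ∀ a : {a : M // ‖a‖ ≤ ρ}, _ := fun a => abs_le.1 <| hδ M X X' _ _ hX hX'
        (snoc_dom hW a) (snoc_dom hW' a) h1 (snoc_close hpos h2 a)
      simp only [TrFormula.eval]
      refine abs_sub_le_iff.2 ⟨sub_le_iff_le_add.2 (ciSup_le fun a => ?_),
        sub_le_iff_le_add.2 (ciSup_le fun a => ?_)⟩
      · linarith [key a, le_ciSup (hbdd M X' W' hX' hW') a]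
      · linarith [key a, le_ciSup (hbdd M X W hX hW) a]
  | @inf k ρ φ ih =>
    obtain ⟨F, hF⟩ := ih
    refine ⟨F, fun r s => ?_⟩
    obtain ⟨⟨C, hC⟩, hF⟩ := hF r (Fin.snoc (α := fun _ : Fin (k + 1) => Ioi (0 : ℝ)) s ρ)
    have hne : ∀ M : TracialWStarAlgebra.{u}, Nonempty {a : M // ‖a‖ ≤ ρ} := fun M =>
      ⟨⟨0, by simpa using ρ.2.le⟩⟩
    have hbdd : ∀ (M : TracialWStarAlgebra.{u}) (X : V → M) (W : Fin k → M), X ∈ M.dom r →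
        W ∈ M.dom s → BddBelow (range fun a : {a : M // ‖a‖ ≤ ρ} => φ.eval M.tr X
          (Fin.snoc (α := fun _ : Fin (k + 1) => (M : Type u)) W a.1)) := fun M X W hX hW =>
      ⟨-C, by rintro _ ⟨a, rfl⟩; exact (abs_le.1 (hC M X _ hX (snoc_dom hW a))).1⟩
    refine ⟨⟨C, fun M X W hX hW => ?_⟩, fun ε hε => ?_⟩
    · have := hne M
      refine abs_le.2 ⟨le_ciInf fun a => (abs_le.1 (hC M X _ hX (snoc_dom hW a))).1, ?_⟩
      exact ciInf_le_of_le (hbdd M X W hX hW) (Classical.arbitrary _)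
        (abs_le.1 (hC M X _ hX (snoc_dom hW _))).2
    · filter_upwards [hF ε hε, pos] with δ hδ hpos M X X' W W' hX hX' hW hW' h1 h2
      have := hne M
      have key : ∀ a : {a : M // ‖a‖ ≤ ρ}, _ := fun a => abs_le.1 <| hδ M X X' _ _ hX hX'
        (snoc_dom hW a) (snoc_dom hW' a) h1 (snoc_close hpos h2 a)
      simp only [TrFormula.eval]
      refine abs_sub_le_iff.2 ⟨sub_le_comm.1 (le_ciInf fun a => ?_),
        sub_le_comm.1 (le_ciInf fun a => ?_)⟩
      · linarith [key a, ciInf_le (hbdd M X W hX hW) a]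
      · linarith [key a, ciInf_le (hbdd M X' W' hX' hW') a]

/-- The value of a formula depends only on finitely many of the variables. -/
theorem TrFormula.exists_support {k : ℕ} (φ : TrFormula V k) :
    ∃ F : Finset V, ∀ (M : TracialWStarAlgebra.{u}) (X X' : V → M) (W : Fin k → M),
      (∀ i ∈ F, X i = X' i) → φ.eval M.tr X W = φ.eval M.tr X' W := by
  obtain ⟨F, hF⟩ := φ.uniform_bound_continuity
  refine ⟨F, fun M X X' W h => eq_of_forall_dist_le fun ε hε => ?_⟩
  -- The radii are adapted to the given tuples, which is allowed because `F` was chosen before the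
  -- radii.
  have hr : ∀ x y : M, 0 < ‖x‖ + ‖y‖ + 1 := fun x y => by positivity
  obtain ⟨δ, hδ, hpos⟩ := (((hF (fun i => ⟨_, hr (X i) (X' i)⟩) (fun j => ⟨_, hr (W j) 0⟩)).2 ε
    hε).and self_mem_nhdsWithin).exists
  refine hδ M X X' W W ?_ ?_ ?_ ?_ ?_ ?_
  · exact fun i => by dsimp only; linarith [norm_nonneg (X' i)]
  · exact fun i => by dsimp only; linarith [norm_nonneg (X i)]
  · exact fun i => by dsimp only; linarith [norm_nonneg (0 : M)]
  · exact fun i => by dsimp only; linarith [norm_nonneg (0 : M)]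
  · intro i hi; simpa [h i hi, norm2_zero] using le_of_lt hpos
  · intro i; simpa [norm2_zero] using le_of_lt hpos

end UniformContinuity

/-! ### Invariance under isomorphisms -/

section Invariance

variable {M N : Type*} [CStarAlgebra M] [CStarAlgebra N]

theorem TrTerm.eval_starAlgEquiv (e : M ≃⋆ₐ[ℂ] N) {V : Type} (X : V → M) (t : TrTerm V) :
    t.eval (e ∘ X) = e (t.eval X) := by
  induction t with
  | poly p t ih =>
    simp only [TrTerm.eval, ih]
    have : FreeAlgebra.lift ℂ (fun i => e ((t i).eval X)) =
        (e.toAlgEquiv : M →ₐ[ℂ] N).comp (FreeAlgebra.lift ℂ fun i => (t i).eval X) := by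
      ext i; simp
    rw [this]; rfl
  | _ => simp_all [TrTerm.eval, map_star]

theorem norm2_starAlgEquiv (e : M ≃⋆ₐ[ℂ] N) {τ : M →ₗ[ℂ] ℂ} {σ : N →ₗ[ℂ] ℂ}
    (h : ∀ x, σ (e x) = τ x) (x : M) : norm2 σ (e x) = norm2 τ x := by
  simp only [norm2, ← map_star, ← map_mul, h]

/-- The quantifiers cause no trouble because *-isomorphisms of C*-algebras are isometric, hence
match the balls bijectively. The result serves both the change of universe for `M_n(ℂ)` and unitary
conjugation. -/
theorem TrFormula.eval_starAlgEquiv (e : M ≃⋆ₐ[ℂ] N) {τ : M →ₗ[ℂ] ℂ} {σ : N →ₗ[ℂ] ℂ}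
    (h : ∀ x, σ (e x) = τ x) {V : Type} (X : V → M) {k : ℕ} (φ : TrFormula V k) (W : Fin k → M) :
    φ.eval σ (e ∘ X) (e ∘ W) = φ.eval τ X W := by
  have hball : ∀ r : ℝ, ∀ a : M, ‖a‖ ≤ r ↔ ‖e a‖ ≤ r := fun r a => by
    rw [NonUnitalStarAlgHom.norm_map e e.injective]
  have hsnoc : ∀ {k : ℕ} (W : Fin k → M) (a : M),
      Fin.snoc (α := fun _ : Fin (k + 1) => N) (e ∘ W) (e a) =
        e ∘ Fin.snoc (α := fun _ : Fin (k + 1) => M) W a := fun W a =>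
    (Fin.comp_snoc e W a).symm
  induction φ with
  | reTr t => simp only [TrFormula.eval, ← Sum.comp_elim, TrTerm.eval_starAlgEquiv, h]
  | imTr t => simp only [TrFormula.eval, ← Sum.comp_elim, TrTerm.eval_starAlgEquiv, h]
  | dist s t =>
    simp only [TrFormula.eval, ← Sum.comp_elim, TrTerm.eval_starAlgEquiv, ← map_sub,
      norm2_starAlgEquiv e h]
  | conn F φ ih => simp only [TrFormula.eval, ih]
  | sup r φ ih =>
    simp only [TrFormula.eval]
    refine ((e.toEquiv.subtypeEquiv (hball r)).iSup_congr fun a => ?_).symm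
    rw [← ih, ← hsnoc]; rfl
  | inf r φ ih =>
    simp only [TrFormula.eval]
    refine ((e.toEquiv.subtypeEquiv (hball r)).iInf_congr fun a => ?_).symm
    rw [← ih, ← hsnoc]; rfl

theorem TrFormula.val_starAlgEquiv (e : M ≃⋆ₐ[ℂ] N) {τ : M →ₗ[ℂ] ℂ} {σ : N →ₗ[ℂ] ℂ}
    (h : ∀ x, σ (e x) = τ x) {V : Type} (X : V → M) (φ : TrFormula V 0) :
    φ.val σ (e ∘ X) = φ.val τ X := by
  rw [TrFormula.val, TrFormula.val, ← φ.eval_starAlgEquiv e h X]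
  congr 1
  ext i; exact i.elim0

end Invariance

/-! ### Matrix algebras as tracial W*-algebras -/

section Matrices

open scoped Matrix.Norms.L2Operator

/-- The isomorphism of a finite-dimensional C*-algebra with its bidual. -/
def toBidual (A : Type u) [CStarAlgebra A] [FiniteDimensional ℂ A] :
    A ≃ₗᵢ[ℂ] StrongDual ℂ (StrongDual ℂ A) :=
  (NormedSpace.inclusionInDoubleDualLi (E := A) ℂ).toLinearIsometryEquiv <| by
    have h : ∀ (E : Type u) [NormedAddCommGroup E] [NormedSpace ℂ E] [FiniteDimensional ℂ E],
        Module.finrank ℂ (StrongDual ℂ E) = Module.finrank ℂ E := fun E _ _ _ => by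
      rw [← (LinearMap.toContinuousLinearMap : (E →ₗ[ℂ] ℂ) ≃ₗ[ℂ] E →L[ℂ] ℂ).finrank_eq]
      exact Subspace.dual_finrank_eq
    rw [h, h]

theorem toBidual_apply (A : Type u) [CStarAlgebra A] [FiniteDimensional ℂ A] (a : A)
    (f : StrongDual ℂ A) : toBidual A a f = f a := rfl

/-- The conjugate-linear identification of a finite-dimensional C*-algebra with its bidual. -/
def bidualEquiv (A : Type u) [CStarAlgebra A] [FiniteDimensional ℂ A] :
    StrongDual ℂ (StrongDual ℂ A) ≃ₗᵢ⋆[ℂ] A :=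
  (toBidual A).symm.trans (starₗᵢ ℂ)

/-- With the dual of `A` as predual, `τ` itself is a point of the predual, and the functional is
evaluation at that point followed by conjugation. The conjugation comes from the conjugate-linear
identification, whence the condition on `star`. -/
theorem continuous_comp_bidualEquiv {A : Type u} [CStarAlgebra A] [FiniteDimensional ℂ A]
    (τ : A →ₗ[ℂ] ℂ) (hτ : ∀ x, τ (star x) = star (τ x)) :
    Continuous fun φ : WeakDual ℂ (StrongDual ℂ A) =>
      τ (bidualEquiv A (WeakDual.toStrongDual φ)) := by
  have h : ∀ φ : WeakDual ℂ (StrongDual ℂ A), τ (bidualEquiv A (WeakDual.toStrongDual φ)) =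
      star (φ (LinearMap.toContinuousLinearMap τ)) := fun φ => by
    obtain ⟨a, ha⟩ := (toBidual A).surjective (WeakDual.toStrongDual φ)
    have h1 : φ (LinearMap.toContinuousLinearMap τ) = τ a := by
      rw [← WeakDual.toStrongDual_apply, ← ha, toBidual_apply]; rfl
    rw [h1, ← hτ, ← ha, bidualEquiv, LinearIsometryEquiv.trans_apply,
      LinearIsometryEquiv.symm_apply_apply, starₗᵢ_apply]
  simp only [h]
  exact (WeakDual.eval_continuous _).star

theorem WStarAlgebra.of_finiteDimensional (A : Type u) [CStarAlgebra A] [FiniteDimensional ℂ A] :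
    WStarAlgebra A :=
  ⟨StrongDual ℂ A, inferInstance, inferInstance, inferInstance, ⟨bidualEquiv A⟩⟩

variable (n : ℕ)

/-- A copy of `M_n(ℂ)` in an arbitrary universe. -/
abbrev LiftMat : Type u := Matrix (ULift.{u} (Fin n)) (ULift.{u} (Fin n)) ℂ

/-- The identification of `M_n(ℂ)` with its copy. -/
def liftMatEquiv : Mat n ≃⋆ₐ[ℂ] LiftMat.{u} n :=
  StarAlgEquiv.ofAlgEquiv (Matrix.reindexAlgEquiv ℂ ℂ Equiv.ulift.symm) fun A => by
    ext; simp [Matrix.star_eq_conjTranspose]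

open scoped ComplexOrder in
/-- `M_n(ℂ)` with its normalized trace as a tracial W*-algebra. -/
def matrixAlgebra [NeZero n] : TracialWStarAlgebra.{u} where
  carrier := LiftMat.{u} n
  wstar := WStarAlgebra.of_finiteDimensional _
  tr := (n : ℂ)⁻¹ • Matrix.traceLinearMap (ULift.{u} (Fin n)) ℂ ℂ
  nonneg' x := by
    have := (Matrix.posSemidef_conjTranspose_mul_self x).trace_nonneg
    simp only [LinearMap.smul_apply, Matrix.traceLinearMap_apply, smul_eq_mul,
      Matrix.star_eq_conjTranspose]
    exact mul_nonneg (by simp) this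
  one' := by simp [Matrix.trace_one, NeZero.ne]
  mul_comm' x y := by simp [Matrix.trace_mul_comm x y]
  faithful' x hx := by
    simpa [Matrix.star_eq_conjTranspose, NeZero.ne, Matrix.trace_conjTranspose_mul_self_eq_zero_iff]
      using hx
  normal' := by
    refine ⟨StrongDual ℂ (LiftMat.{u} n), inferInstance, inferInstance, inferInstance,
      bidualEquiv _, continuous_comp_bidualEquiv _ fun x => ?_⟩
    simp [Matrix.star_eq_conjTranspose, Matrix.trace_conjTranspose]

theorem matrixAlgebra_tr [NeZero n] (x : Mat n) :
    (matrixAlgebra.{u} n).tr (liftMatEquiv.{u} n x) = ntr n x := by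
  change (n : ℂ)⁻¹ • ∑ i : ULift.{u} (Fin n), x i.down i.down = (n : ℂ)⁻¹ • ∑ i, x i i
  congr 1
  exact Equiv.ulift.sum_comp fun i => x i i

/-- Conjugation by a unitary matrix. -/
def conjEquiv (V : Matrix.unitaryGroup (Fin n) ℂ) : Mat n ≃⋆ₐ[ℂ] Mat n :=
  Unitary.conjStarAlgAut ℂ (Mat n) V

theorem conjEquiv_apply (V : Matrix.unitaryGroup (Fin n) ℂ) (x : Mat n) :
    conjEquiv n V x = V * x * star (V : Mat n) := by
  simp [conjEquiv, Unitary.conjStarAlgAut_apply]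

theorem ntr_conjEquiv (V : Matrix.unitaryGroup (Fin n) ℂ) (x : Mat n) :
    ntr n (conjEquiv n V x) = ntr n x := by
  rw [conjEquiv_apply]
  simp only [ntr, LinearMap.smul_apply, Matrix.traceLinearMap_apply]
  rw [Matrix.trace_mul_comm, ← mul_assoc]
  simp

end Matrices

/-! ### Quantification over free variables -/

section Quantification

/-- The renaming of variables that makes some of the free variables available to be bound. -/
def bindIndex {V W : Type} {m : ℕ} (g : V → W ⊕ Fin m) (k : ℕ) : V ⊕ Fin k → W ⊕ Fin (m + k) :=
  Sum.elim (Sum.map id (Fin.castAdd k) ∘ g) (Sum.inr ∘ Fin.natAdd m)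

/-- Make some of the free variables of a formula available to be bound. -/
def TrFormula.bindFree {V W : Type} {m : ℕ} (g : V → W ⊕ Fin m) :
    {k : ℕ} → TrFormula V k → TrFormula W (m + k)
  | k, .reTr t => .reTr (t.rename (bindIndex g k))
  | k, .imTr t => .imTr (t.rename (bindIndex g k))
  | k, .dist s t => .dist (s.rename (bindIndex g k)) (t.rename (bindIndex g k))
  | _, .conn F φ => .conn F (fun i => (φ i).bindFree g)
  | _, .sup r φ => .sup r (φ.bindFree g)
  | _, .inf r φ => .inf r (φ.bindFree g)

/-- The newly bindable variables precede those that `φ` binds itself, so a quantifier, which extends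
the tuple at its end, commutes with the renaming. -/
theorem TrFormula.eval_bindFree {M : Type*} [CStarAlgebra M] (τ : M →ₗ[ℂ] ℂ) {V W : Type} {m : ℕ}
    (g : V → W ⊕ Fin m) (Y : W → M) (Z : Fin m → M) {k : ℕ} (φ : TrFormula V k) (T : Fin k → M) :
    (φ.bindFree g).eval τ Y (Fin.append Z T) = φ.eval τ (Sum.elim Y Z ∘ g) T := by
  have h : ∀ {k : ℕ} (T : Fin k → M), Sum.elim Y (Fin.append Z T) ∘ bindIndex g k =
      Sum.elim (Sum.elim Y Z ∘ g) T := fun T => by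
    ext (i | i)
    · rcases hg : g i with j | j <;> simp [bindIndex, hg]
    · simp [bindIndex]
  induction φ with
  | reTr t => simp only [TrFormula.bindFree, TrFormula.eval, TrTerm.eval_rename, h]
  | imTr t => simp only [TrFormula.bindFree, TrFormula.eval, TrTerm.eval_rename, h]
  | dist s t => simp only [TrFormula.bindFree, TrFormula.eval, TrTerm.eval_rename, h]
  | conn F φ ih => simp only [TrFormula.bindFree, TrFormula.eval, ih]
  | sup r φ ih =>
    simp only [TrFormula.bindFree, TrFormula.eval, ← ih, Fin.append_snoc]
  | inf r φ ih =>
    simp only [TrFormula.bindFree, TrFormula.eval, ← ih, Fin.append_snoc]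

/-- The strict inequality yields a witness without the infimum being attained. -/
theorem TrFormula.eval_inf_lt_iff {V : Type} {k : ℕ} (φ : TrFormula V (k + 1)) (r : Ioi (0 : ℝ))
    (M : TracialWStarAlgebra.{u}) (X : V → M) (W : Fin k → M) (c : ℝ) :
    (TrFormula.inf r φ).eval M.tr X W < c ↔ ∃ a : M, ‖a‖ ≤ r ∧
      φ.eval M.tr X (Fin.snoc (α := fun _ : Fin (k + 1) => (M : Type u)) W a) < c := by
  have hne : Nonempty {a : M // ‖a‖ ≤ r} := ⟨⟨0, by simpa using r.2.le⟩⟩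
  have hpos : ∀ x : M, 0 < ‖x‖ + 1 := fun x => by positivity
  obtain ⟨F, hF⟩ := φ.uniform_bound_continuity
  obtain ⟨C, hC⟩ := (hF (fun i => ⟨_, hpos (X i)⟩)
    (Fin.snoc (α := fun _ : Fin (k + 1) => Ioi (0 : ℝ)) (fun i => ⟨_, hpos (W i)⟩) r)).1
  have hbdd : BddBelow (range fun a : {a : M // ‖a‖ ≤ r} => φ.eval M.tr X
      (Fin.snoc (α := fun _ : Fin (k + 1) => (M : Type u)) W a.1)) := by
    refine ⟨-C, ?_⟩
    rintro _ ⟨a, rfl⟩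
    refine (abs_le.1 (hC M X _ (fun i => by simp) fun j => ?_)).1
    refine Fin.lastCases ?_ (fun j => ?_) j
    · simpa using a.2
    · simp
  simp only [TrFormula.eval]
  rw [ciInf_lt_iff hbdd]
  simp

/-- The infimum of a formula over balls, taken in all the variables available to be bound. -/
def TrFormula.infClosure {W : Type} :
    {m : ℕ} → (Fin m → Ioi (0 : ℝ)) → TrFormula W m → TrFormula W 0
  | 0, _, φ => φ
  | m + 1, s, φ => infClosure (fun i => s i.castSucc) (.inf (s (Fin.last m)) φ)

theorem TrFormula.val_infClosure_lt_iff {W : Type} (M : TracialWStarAlgebra.{u}) (X : W → M)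
    (c : ℝ) {m : ℕ} (s : Fin m → Ioi (0 : ℝ)) (φ : TrFormula W m) :
    (φ.infClosure s).val M.tr X < c ↔ ∃ Z ∈ M.dom s, φ.eval M.tr X Z < c := by
  induction m with
  | zero =>
    refine ⟨fun h => ⟨Fin.elim0, fun i => i.elim0, h⟩, ?_⟩
    rintro ⟨Z, -, h⟩
    rwa [Subsingleton.elim Z Fin.elim0] at h
  | succ m ih =>
    simp only [TrFormula.infClosure]
    rw [ih]
    constructor
    · rintro ⟨Z, hZ, h⟩
      obtain ⟨a, ha, h⟩ := (φ.eval_inf_lt_iff _ M X Z c).1 h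
      refine ⟨_, fun j => ?_, h⟩
      refine Fin.lastCases ?_ (fun j => ?_) j
      · simpa using ha
      · simpa using hZ j
    · rintro ⟨Z, hZ, h⟩
      refine ⟨fun i => Z i.castSucc, fun i => hZ i.castSucc,
        (φ.eval_inf_lt_iff _ M X _ c).2 ⟨Z (Fin.last m), hZ (Fin.last m), ?_⟩⟩
      convert h
      exact Fin.snoc_init_self Z

/-- Being below a constant for some value of the left variables in a product of balls is expressed
by a formula in the right variables. -/
theorem TrFormula.exists_inf_left (φ : TrFormula (ℕ ⊕ ℕ) 0) (r : ℕ → Ioi (0 : ℝ)) :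
    ∃ χ : TrFormula ℕ 0, ∀ (M : TracialWStarAlgebra.{u}) (Y : ℕ → M) (c : ℝ),
      χ.val M.tr Y < c ↔ ∃ X ∈ M.dom r, φ.val M.tr (Sum.elim X Y) < c := by
  obtain ⟨F, hF⟩ := φ.exists_support
  obtain ⟨N, hN⟩ := F.toLeft.exists_nat_subset_range
  -- Left variables of index at least `N` lie outside the support, so their image `Sum.inl 0` is
  -- arbitrary.
  let g : ℕ ⊕ ℕ → ℕ ⊕ Fin N :=
    Sum.elim (fun j => if h : j < N then Sum.inr ⟨j, h⟩ else Sum.inl 0) Sum.inl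
  have hval : ∀ (M : TracialWStarAlgebra.{u}) (Y : ℕ → M) (Z : Fin N → M),
      (φ.bindFree g).eval M.tr Y Z = φ.val M.tr (Sum.elim Y Z ∘ g) := fun M Y Z => by
    have := φ.eval_bindFree M.tr g Y Z Fin.elim0
    rwa [Fin.append_elim0] at this
  have hsupp : ∀ (M : TracialWStarAlgebra.{u}) (X Y : ℕ → M) (Z : Fin N → M),
      (∀ i : Fin N, X i = Z i) →
      φ.val M.tr (Sum.elim Y Z ∘ g) = φ.val M.tr (Sum.elim X Y) := fun M X Y Z h => by
    refine hF M _ _ _ ?_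
    rintro (i | i) hi
    · have hi' : i < N := Finset.mem_range.1 (hN (by simpa using hi))
      simp [g, hi', ← h ⟨i, hi'⟩]
    · simp [g]
  refine ⟨(φ.bindFree g).infClosure fun i : Fin N => r i, fun M Y c => ?_⟩
  have key := TrFormula.val_infClosure_lt_iff M Y c (fun i : Fin N => r i) (φ.bindFree g)
  refine key.trans ⟨?_, ?_⟩
  · rintro ⟨Z, hZ, h⟩
    -- Entries beyond `N` do not affect `φ`; `0` is used because it lies in every ball.
    refine ⟨fun j => if h : j < N then Z ⟨j, h⟩ else 0, fun j => ?_, ?_⟩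
    · by_cases hj : j < N
      · simpa [hj] using hZ ⟨j, hj⟩
      · simpa [hj] using (r j).2.le
    · rw [hval, hsupp M (fun j => if h : j < N then Z ⟨j, h⟩ else 0) Y Z (by simp)] at h
      exact h
  · rintro ⟨X, hX, h⟩
    refine ⟨fun i => X i, fun i => hX i, ?_⟩
    rw [hval, hsupp M X Y _ fun i => rfl]
    exact h

end Quantification

/-! ### The logic topology -/

section LogicTopology

theorem isOpen_typeSpace_iff {O : Set TypeSpace.{u}} :
    IsOpen O ↔ ∀ r : ℕ → Ioi (0 : ℝ), IsOpen (typesIncl.{u} r ⁻¹' O) := by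
  rw [isOpen_iSup_iff]
  simp only [isOpen_coinduced]

theorem isOpen_setOf_apply_lt (φ : TrFormula ℕ 0) (c : ℝ) :
    IsOpen {μ : TypeSpace.{u} | μ.1 φ < c} :=
  isOpen_typeSpace_iff.2 fun _ => isOpen_lt ((continuous_apply φ).comp continuous_subtype_val)
    continuous_const

/-- Sublevel sets of single formulas form a neighbourhood base in the space of types of tuples from
a product of balls. -/
theorem exists_formula_lt_subset {O : Set TypeSpace.{u}} (hO : IsOpen O) {r : ℕ → Ioi (0 : ℝ)}
    {μ : typesIn.{u} r} (hμ : typesIncl r μ ∈ O) {c : ℝ} (hc : 0 < c) :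
    ∃ θ : TrFormula ℕ 0, μ.1 θ < c ∧
      ∀ ν : typesIn.{u} r, ν.1 θ < c → typesIncl r ν ∈ O := by
  obtain ⟨S, hS, hSO⟩ := isOpen_induced_iff.1 (isOpen_typeSpace_iff.1 hO r)
  have hμS : μ.1 ∈ S := by
    change μ ∈ Subtype.val ⁻¹' S
    rw [hSO]; exact hμ
  obtain ⟨I, v, hv, hvS⟩ := isOpen_pi_iff.1 hS μ.1 hμS
  let e := I.equivFin.symm
  have hopen : IsOpen (pi univ fun i => v (e i)) :=
    isOpen_set_pi finite_univ fun i _ => (hv _ (e i).2).1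
  obtain ⟨δ, hδ, hball⟩ := Metric.isOpen_iff.1 hopen (fun i => μ.1 (e i))
    fun i _ => (hv _ (e i).2).2
  -- Distance in `ℝᵏ` to the values of `μ` is a connective; scaling by `c / δ` turns the ball of
  -- radius `δ` into the sublevel set at `c`.
  refine ⟨.conn ⟨fun w => c / δ * dist w fun i => μ.1 (e i), by fun_prop⟩ fun i => (e i).1,
    ?_, fun ν hν => ?_⟩
  all_goals
    have heval : ∀ ν : typesIn.{u} r, ν.1 (.conn ⟨fun w => c / δ * dist w fun i => μ.1 (e i),
        by fun_prop⟩ fun i => (e i).1) =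
        c / δ * dist (fun i => ν.1 (e i).1) fun i => μ.1 (e i) := by
      -- A type is a bare function on formulas; it respects connectives because it is realised by a
      -- tuple.
      rintro ⟨_, M, X, -, rfl⟩
      rfl
    rw [heval] at *
  · simpa using hc
  · have hlt : dist (fun i => ν.1 (e i).1) (fun i => μ.1 (e i)) < δ := by
      rw [div_mul_eq_mul_div, div_lt_iff₀ hδ] at hν
      exact lt_of_mul_lt_mul_left hν hc.le
    have hmem := hball (Metric.mem_ball.2 hlt)
    have hνS : ν.1 ∈ S := hvS fun φ hφ => by
      simpa [e] using hmem (I.equivFin ⟨φ, hφ⟩) (mem_univ _)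
    change ν ∈ typesIncl r ⁻¹' O
    rw [← hSO]; exact hνS

end LogicTopology

/-! ### Comparison of covering numbers -/

section Covering

open scoped Matrix.Norms.L2Operator

variable {n : ℕ}

theorem norm2_liftMatEquiv [NeZero n] (x : Mat n) :
    norm2 (matrixAlgebra.{u} n).tr (liftMatEquiv.{u} n x) = norm2 (ntr n) x :=
  norm2_starAlgEquiv (liftMatEquiv.{u} n) (matrixAlgebra_tr n) x

theorem norm_liftMatEquiv [NeZero n] (x : Mat n) :
    ‖(show matrixAlgebra.{u} n from liftMatEquiv.{u} n x)‖ = ‖x‖ :=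
  NonUnitalStarAlgHom.norm_map (liftMatEquiv.{u} n) (liftMatEquiv.{u} n).injective x

theorem TrFormula.val_liftMatEquiv [NeZero n] {V : Type} (φ : TrFormula V 0) (X : V → Mat n) :
    φ.val (matrixAlgebra.{u} n).tr (liftMatEquiv.{u} n ∘ X) = φ.val (ntr n) X :=
  φ.val_starAlgEquiv (liftMatEquiv.{u} n) (matrixAlgebra_tr n) X

theorem norm2_ntr_sub_le [NeZero n] (x y z : Mat n) :
    norm2 (ntr n) (x - z) ≤ norm2 (ntr n) (x - y) + norm2 (ntr n) (y - z) := by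
  simp only [← norm2_liftMatEquiv.{0}, map_sub]
  exact norm2_sub_le (matrixAlgebra.{0} n) _ _ _

theorem norm2_ntr_sub_comm [NeZero n] (x y : Mat n) :
    norm2 (ntr n) (x - y) = norm2 (ntr n) (y - x) := by
  simp only [← norm2_liftMatEquiv.{0}, map_sub]
  exact norm2_sub_comm (matrixAlgebra.{0} n) _ _

theorem norm2_ntr_conj {V : Mat n} (hV : V ∈ Matrix.unitaryGroup (Fin n) ℂ) (x : Mat n) :
    norm2 (ntr n) (V * x * star V) = norm2 (ntr n) x := by
  simpa only [conjEquiv_apply] using norm2_starAlgEquiv (conjEquiv n ⟨V, hV⟩)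
    (ntr_conjEquiv n ⟨V, hV⟩) x

/-- If a relation between tuples sends orbitally close tuples to orbitally close tuples, then
orbital covering numbers do not increase along it. -/
theorem orbCov_le_of_relation [NeZero n] {Γ Γ' : Set (ℕ → Mat n)} {F F' : Finset ℕ} {δ ε : ℝ}
    (R : (ℕ → Mat n) → (ℕ → Mat n) → Prop) (hR : ∀ Y ∈ Γ', ∃ X ∈ Γ, R X Y)
    (hclose : ∀ X ∈ Γ, ∀ X' ∈ Γ, ∀ Y ∈ Γ', ∀ Y' ∈ Γ', ∀ V ∈ Matrix.unitaryGroup (Fin n) ℂ,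
      R X Y → R X' Y' → (∀ i ∈ F, norm2 (ntr n) (X i - V * X' i * star V) < 2 * δ) →
      ∀ i ∈ F', norm2 (ntr n) (Y i - V * Y' i * star V) < ε) :
    orbCov F' ε Γ' ≤ orbCov F δ Γ := by
  classical
  refine le_iInf₂ fun Ω hΩ => ?_
  let P : (ℕ → Mat n) → Prop := fun Z => ∃ Y ∈ Γ', ∃ X ∈ Γ, R X Y ∧
    ∃ V ∈ Matrix.unitaryGroup (Fin n) ℂ, ∀ i ∈ F, norm2 (ntr n) (X i - V * Z i * star V) < δ
  -- Each useful centre `Z` is replaced by a `Y` whose partner is `δ`-close to the orbit of `Z`. Two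
  -- partners near the same `Z` are within `2 * δ` up to conjugation.
  let f : (ℕ → Mat n) → ℕ → Mat n := fun Z => if h : P Z then h.choose else 0
  refine (iInf₂_le (f '' Ω) fun Y hY => ?_).trans (encard_image_le f Ω)
  obtain ⟨X, hX, hXY⟩ := hR Y hY
  obtain ⟨V, hV, Z, hZ, hVZ⟩ := hΩ hX
  have hP : P Z := ⟨Y, hY, X, hX, hXY, V, hV, hVZ⟩
  obtain ⟨hY', X', hX', hXY', V', hV', hVZ'⟩ := hP.choose_spec
  have hf : f Z = hP.choose := dif_pos hP
  have hW : V * star V' ∈ Matrix.unitaryGroup (Fin n) ℂ := mul_mem hV (Unitary.star_mem hV')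
  refine ⟨V * star V', hW, f Z, mem_image_of_mem f hZ, ?_⟩
  rw [hf]
  refine hclose X hX X' hX' Y hY _ hY' _ hW hXY hXY' fun i hi => ?_
  have h1 := hVZ i hi
  have h2 := hVZ' i hi
  have hVV : star V' * V' = 1 := Unitary.star_mul_self_of_mem hV'
  have e : V * star V' * (X' i - V' * Z i * star V') * star (V * star V') =
      V * star V' * X' i * star (V * star V') - V * Z i * star V := by
    rw [mul_sub, sub_mul]
    congr 1
    calc _ = V * (star V' * V') * Z i * (star V' * V') * star V := by
          simp only [star_mul, star_star, mul_assoc]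
      _ = _ := by rw [hVV, mul_one, mul_one]
  have e' : norm2 (ntr n) (V * Z i * star V - V * star V' * X' i * star (V * star V')) < δ := by
    rwa [norm2_ntr_sub_comm, ← e, norm2_ntr_conj hW]
  linarith [norm2_ntr_sub_le (X i) (V * Z i * star V) (V * star V' * X' i * star (V * star V'))]

end Covering

/-! ### Transfer of covering entropy along formulas -/

section Transfer

theorem eventually_neZero {U : Ultrafilter ℕ} (hU : U ≠ pure 0) :
    ∀ᶠ n in (U : Filter ℕ), n ≠ 0 := by
  have h : {0} ∉ U := fun h => hU (Ultrafilter.coe_injective (by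
    refine (U.neBot.eq_pure_iff).2 h))
  exact Ultrafilter.compl_mem_iff_notMem.2 h

/-- Limits along an ultrafilter exist in the compact space `EReal` and preserve inequalities, so it
suffices to compare covering numbers neighbourhood by neighbourhood. -/
theorem entAt_le_of_eventually_orbCov_le {U : Ultrafilter ℕ} {r r' : ℕ → Ioi (0 : ℝ)}
    {F F' : Finset ℕ} {δ ε : ℝ} {K K' : Set TypeSpace.{u}}
    (h : ∀ O, IsOpen O → K ⊆ O → ∃ O', IsOpen O' ∧ K' ⊆ O' ∧ ∀ᶠ n in (U : Filter ℕ),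
      orbCov F' ε (microstates r' n O') ≤ orbCov F δ (microstates r n O)) :
    entAt U r' F' ε K' ≤ entAt U r F δ K := by
  refine le_iInf fun O => le_iInf₂ fun hO hKO => ?_
  obtain ⟨O', hO', hKO', hev⟩ := h O hO hKO
  refine iInf_le_of_le O' (iInf₂_le_of_le hO' hKO' ?_)
  refine le_of_tendsto_of_tendsto (tendsto_ulim U _) (tendsto_ulim U _) ?_
  filter_upwards [hev] with n hn
  refine mul_le_mul_of_nonneg_left ?_ (EReal.coe_nonneg.2 (by positivity))
  exact ENNReal.log_monotone (ENat.toENNReal_le.2 hn)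

open scoped Matrix.Norms.L2Operator in
/-- Covering entropy does not increase along a relation `ψ(x, y) < c` given by a formula for which
`y` is determined by `x` up to a small error. -/
theorem entBdd_le_of_formula {U : Ultrafilter ℕ} (hU : U ≠ pure 0) {r r' : ℕ → Ioi (0 : ℝ)}
    {K K' : Set TypeSpace.{u}}
    (h : ∀ (N : ℕ) (ε : ℝ), 0 < ε → ∃ (ψ : TrFormula (ℕ ⊕ ℕ) 0) (c : ℝ), 0 < c ∧
      (∀ ν ∈ K', ∃ (M : TracialWStarAlgebra.{u}) (X Y : ℕ → M), X ∈ M.dom r ∧ typeOf M X ∈ K ∧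
        typeOf M Y = ν ∧ ψ.val M.tr (Sum.elim X Y) < c) ∧
      ∀ (M : TracialWStarAlgebra.{u}) (X Y Y' : ℕ → M), X ∈ M.dom r → Y ∈ M.dom r' →
        Y' ∈ M.dom r' → ψ.val M.tr (Sum.elim X Y) < 2 * c → ψ.val M.tr (Sum.elim X Y') < 2 * c →
        ∀ i < N, norm2 M.tr (Y i - Y' i) < ε) :
    entBdd U r' K' ≤ entBdd U r K := by
  refine iSup_le fun F' => iSup₂_le fun ε hε => ?_
  obtain ⟨N, hN⟩ := F'.exists_nat_subset_range
  obtain ⟨ψ, c, hc, hK', hψ⟩ := h N ε hε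
  obtain ⟨F, hF⟩ := ψ.uniform_bound_continuity
  -- An error of `c / 2` keeps values below `c` under `2 * c`.
  obtain ⟨δ, hδ, hpos⟩ := (((hF (Sum.elim r r') Fin.elim0).2 (c / 2) (half_pos hc)).and
    self_mem_nhdsWithin).exists
  have hpos : 0 < δ := hpos
  have hcont : ∀ (M : TracialWStarAlgebra.{u}) (X X' Y : ℕ → M), X ∈ M.dom r → X' ∈ M.dom r →
      Y ∈ M.dom r' → (∀ i ∈ F.toLeft, norm2 M.tr (X i - X' i) < δ) →
      ψ.val M.tr (Sum.elim X' Y) < c → ψ.val M.tr (Sum.elim X Y) < 2 * c := by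
    intro M X X' Y hX hX' hY hclose hlt
    have := hδ M (Sum.elim X Y) (Sum.elim X' Y) Fin.elim0 Fin.elim0 ?_ ?_ (fun i => i.elim0)
      (fun i => i.elim0) ?_ (fun i => i.elim0)
    · have h2 := (abs_le.1 this).2
      simp only [TrFormula.val] at hlt ⊢
      linarith
    · rintro (i | i)
      exacts [hX i, hY i]
    · rintro (i | i)
      exacts [hX' i, hY i]
    · rintro (i | i) hi
      · exact (hclose i (by simpa using hi)).le
      · simpa [norm2_zero] using hpos.le
  -- The cover is taken at scale `δ / 2` because comparing two partners through a common centre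
  -- doubles the distance.
  refine le_trans ?_ (le_iSup_of_le F.toLeft (le_iSup₂_of_le (δ / 2) (half_pos hpos) le_rfl))
  refine entAt_le_of_eventually_orbCov_le fun O hO hKO => ?_
  choose M X Y hX hXK hY hψc using hK'
  have hθ : ∀ ν (hν : ν ∈ K'), ∃ χ : TrFormula ℕ 0, χ.val (M ν hν).tr (Y ν hν) < c ∧
      ∀ (M : TracialWStarAlgebra.{u}) (Y : ℕ → M), χ.val M.tr Y < c →
        ∃ X ∈ M.dom r, typeOf M X ∈ O ∧ ψ.val M.tr (Sum.elim X Y) < c := by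
    intro ν hν
    obtain ⟨θ, hθ, hθO⟩ := exists_formula_lt_subset hO
      (μ := ⟨tp (M ν hν).tr (X ν hν), M ν hν, X ν hν, hX ν hν, rfl⟩) (hKO (hXK ν hν)) hc
    obtain ⟨χ, hχ⟩ := TrFormula.exists_inf_left.{u}
      (.conn ⟨fun w : Fin 2 → ℝ => max (w 0) (w 1), by fun_prop⟩ ![ψ, θ.rename Sum.inl]) r
    have hval : ∀ (M : TracialWStarAlgebra.{u}) (X Y : ℕ → M), TrFormula.val M.tr
        (.conn ⟨fun w : Fin 2 → ℝ => max (w 0) (w 1), by fun_prop⟩ ![ψ, θ.rename Sum.inl])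
        (Sum.elim X Y) = max (ψ.val M.tr (Sum.elim X Y)) (tp M.tr X θ) := fun M X Y => by
      simp [TrFormula.val, TrFormula.eval, tp, TrFormula.eval_rename]
    simp only [hval, max_lt_iff] at hχ
    refine ⟨χ, (hχ _ _ _).2 ⟨X ν hν, hX ν hν, hψc ν hν, hθ⟩, fun M Y hY => ?_⟩
    obtain ⟨X, hX, h1, h2⟩ := (hχ _ _ _).1 hY
    exact ⟨X, hX, hθO ⟨tp M.tr X, M, X, hX, rfl⟩ h2, h1⟩
  choose χ hχY hχ using hθ
  -- A union over all of `K'` suffices: a microstate needs only one `ν` that provides its partner,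
  -- so no finite subcover is required.
  refine ⟨⋃ (ν) (hν : ν ∈ K'), {μ | μ.1 (χ ν hν) < c},
    isOpen_iUnion fun ν => isOpen_iUnion fun hν => isOpen_setOf_apply_lt _ _,
    fun ν hν => mem_iUnion₂.2 ⟨ν, hν, ?_⟩, ?_⟩
  · have : ν.1 = tp (M ν hν).tr (Y ν hν) := (congrArg Subtype.val (hY ν hν)).symm
    exact (congrFun this (χ ν hν)).trans_lt (hχY ν hν)
  -- For `n = 0` the normalized trace is not a state.
  filter_upwards [eventually_neZero hU] with n hn
  have : NeZero n := ⟨hn⟩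
  let e := liftMatEquiv.{u} n
  have lift_mem_dom : ∀ (s : ℕ → Ioi (0 : ℝ)) (X : ℕ → Mat n),
      (∀ j, ‖X j‖ ≤ s j) → (fun j => e (X j)) ∈ (matrixAlgebra.{u} n).dom s := fun s X hX j =>
    (norm_liftMatEquiv.{u} (X j)).trans_le (hX j)
  have elim_val : ∀ X Y : ℕ → Mat n, ψ.val (matrixAlgebra.{u} n).tr
      (Sum.elim (fun j => e (X j)) fun j => e (Y j)) = ψ.val (ntr n) (Sum.elim X Y) :=
    fun X Y => by
      have h : Sum.elim (fun j => e (X j)) (fun j => e (Y j)) = e ∘ Sum.elim X Y :=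
        (Sum.comp_elim e X Y).symm
      exact (congrArg (ψ.val (matrixAlgebra.{u} n).tr) h).trans
        (TrFormula.val_liftMatEquiv.{u} ψ (Sum.elim X Y))
  refine orbCov_le_of_relation (fun X Y => ψ.val (ntr n) (Sum.elim X Y) < c) ?_ ?_
  · rintro Y ⟨hYr, μ, hμ, hμY⟩
    obtain ⟨ν, hν, hlt⟩ := mem_iUnion₂.1 hμ
    obtain ⟨X, hX, hXO, hXY⟩ := hχ ν hν (matrixAlgebra.{u} n) (fun j => e (Y j)) (by
      have h1 := TrFormula.val_liftMatEquiv.{u} (χ ν hν) Y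
      have h2 : μ.1 (χ ν hν) = (χ ν hν).val (ntr n) Y := congrFun hμY _
      exact (h1.trans h2.symm).trans_lt hlt)
    obtain ⟨X, rfl⟩ : ∃ X' : ℕ → Mat n, X = fun j => e (X' j) :=
      ⟨fun j => e.symm (X j), by ext1 j; exact (e.apply_symm_apply _).symm⟩
    refine ⟨X, ⟨fun j => (norm_liftMatEquiv.{u} (X j)).symm.trans_le (hX j), _, hXO, ?_⟩, ?_⟩
    · funext φ
      exact TrFormula.val_liftMatEquiv.{u} φ X
    · rwa [elim_val] at hXY
  · rintro X ⟨hX, -⟩ X' ⟨hX', -⟩ Y ⟨hY, -⟩ Y' ⟨hY', -⟩ V hV hXY hXY' hclose i hi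
    let γ := conjEquiv n ⟨V, hV⟩
    have hγ : ∀ x, γ x = V * x * star V := conjEquiv_apply n ⟨V, hV⟩
    have hγn : ∀ x, ‖γ x‖ = ‖x‖ := NonUnitalStarAlgHom.norm_map γ γ.injective
    -- Conjugating `X'` and `Y'` by the same unitary leaves `ψ` unchanged.
    have hconj : ψ.val (ntr n) (Sum.elim (fun j => γ (X' j)) fun j => γ (Y' j)) < c := by
      have := ψ.val_starAlgEquiv γ (ntr_conjEquiv n ⟨V, hV⟩) (Sum.elim X' Y')
      rw [Sum.comp_elim] at this
      exact this.trans_lt hXY'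
    have hdX := lift_mem_dom r X hX
    have hdX' := lift_mem_dom r (fun j => γ (X' j)) fun j => (hγn _).trans_le (hX' j)
    have hdY := lift_mem_dom r' Y hY
    have hdY' := lift_mem_dom r' (fun j => γ (Y' j)) fun j => (hγn _).trans_le (hY' j)
    have h1 := hcont (matrixAlgebra.{u} n) _ _ _ hdX hdX' hdY' (fun j hj => by
      have := hclose j hj
      rw [mul_div_cancel₀ _ two_ne_zero, ← hγ, ← norm2_liftMatEquiv.{u}, map_sub] at this
      exact this) (by rwa [elim_val])
    have h2 := hψ (matrixAlgebra.{u} n) _ _ _ hdX hdY hdY'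
      (by rw [elim_val]; exact hXY.trans (by linarith)) h1 i (Finset.mem_range.1 (hN hi))
    rw [← hγ, ← norm2_liftMatEquiv.{u}, map_sub]
    exact h2

end Transfer

/-! ### Approximation of elements of a generated W*-subalgebra -/

section Generation

variable (M : TracialWStarAlgebra.{u})

theorem exists_term_eval_of_mem_adjoin {X : ℕ → M} {x : M}
    (hx : x ∈ StarAlgebra.adjoin ℂ (range X)) : ∃ t : TrTerm ℕ, t.eval X = x := by
  induction hx using StarAlgebra.adjoin_induction with
  | mem x h => obtain ⟨i, rfl⟩ := h; exact ⟨.var i, rfl⟩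
  | algebraMap c => exact ⟨.smul c .one, by simp [TrTerm.eval, Algebra.algebraMap_eq_smul_one]⟩
  | add x y _ _ hx hy =>
    obtain ⟨s, rfl⟩ := hx
    obtain ⟨t, rfl⟩ := hy
    exact ⟨.add s t, rfl⟩
  | mul x y _ _ hx hy =>
    obtain ⟨s, rfl⟩ := hx
    obtain ⟨t, rfl⟩ := hy
    exact ⟨.mul s t, rfl⟩
  | star x _ hx =>
    obtain ⟨s, rfl⟩ := hx
    exact ⟨.adj s, rfl⟩

/-- The class of `1` is sent by `x` to the class of `x`; evaluating there converts strong operator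
approximation into 2-norm approximation. -/
theorem norm_stdRep_sub_apply_one (x y : M) :
    ‖M.stdRep x (M.state.toPreGNS 1 : M.state.PreGNS) -
      M.stdRep y (M.state.toPreGNS 1 : M.state.PreGNS)‖ = norm2 M.tr (x - y) := by
  have h : ∀ z : M, M.stdRep z (M.state.toPreGNS 1 : M.state.PreGNS) =
      ((M.state.toPreGNS z : M.state.PreGNS) : M.state.GNS) := fun z => by
    have := PositiveLinearMap.gnsNonUnitalStarAlgHom_apply_coe M.state (a := z)
      (b := M.state.toPreGNS 1)
    refine Eq.trans this ?_
    simp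
  rw [h, h, ← UniformSpace.Completion.coe_sub, UniformSpace.Completion.norm_coe, ← map_sub,
    norm2_eq_norm_toPreGNS]

/-- Elements of `W*(X)` are approximated in 2-norm by terms in `X`. -/
theorem exists_term_norm2_lt {X : ℕ → M} {y : M} (hy : y ∈ M.wstarGen X) {ε : ℝ} (hε : 0 < ε) :
    ∃ t : TrTerm ℕ, norm2 M.tr (t.eval X - y) < ε := by
  let ξ : M.state.GNS := (M.state.toPreGNS 1 : M.state.PreGNS)
  have hcont : Continuous fun T : M.state.GNS →Lₚₜ[ℂ] M.state.GNS => ‖T ξ - M.stdRep y ξ‖ :=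
    ((PointwiseConvergenceCLM.evalCLM (RingHom.id ℂ) M.state.GNS ξ).continuous.sub
      continuous_const).norm
  obtain ⟨_, hT, x, hx, rfl⟩ := mem_closure_iff.1 hy _ (isOpen_lt hcont continuous_const)
    (show ‖M.stdRep y ξ - M.stdRep y ξ‖ < ε by simpa using hε)
  obtain ⟨t, rfl⟩ := exists_term_eval_of_mem_adjoin M hx
  exact ⟨t, by rw [← norm_stdRep_sub_apply_one]; exact hT⟩

theorem mem_wstarGen (X : ℕ → M) (j : ℕ) : X j ∈ M.wstarGen X :=
  subset_closure (mem_image_of_mem _ (StarAlgebra.subset_adjoin ℂ _ (mem_range_self j)))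

end Generation

/-! ### Monotonicity -/

section Monotonicity

theorem entBdd_pushforward_le {U : Ultrafilter ℕ} (hU : U ≠ pure 0) (f : DefinableFunction.{u})
    {r r' : ℕ → Ioi (0 : ℝ)}
    (hf : ∀ M : TracialWStarAlgebra.{u}, MapsTo (f M) (M.dom r) (M.dom r'))
    {K : Set TypeSpace.{u}} (hK : K ⊆ boundedTypes r) :
    entBdd U r' (f.pushforward '' K) ≤ entBdd U r K := by
  refine entBdd_le_of_formula hU fun N ε hε => ?_
  let φ : TrFormula (ℕ ⊕ ℕ) 0 := .conn ⟨fun w : Fin N → ℝ => ∑ i, w i, by fun_prop⟩ fun i =>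
    .dist (.var (.inl (.inl i))) (.var (.inl (.inr i)))
  have hφ : ∀ (M : TracialWStarAlgebra.{u}) (X Y : ℕ → M), φ.val M.tr (Sum.elim X Y) =
      ∑ i : Fin N, norm2 M.tr (X i - Y i) := fun M X Y => by
    simp [φ, TrFormula.val, TrFormula.eval, TrTerm.eval]
  -- With `c = ε / 6`, the graph of `f` lies in `ψ < c`, while `ψ < 2 * c` gives a sum below `ε / 6
  -- + ε / 3 = ε / 2`; the triangle inequality through `f(X)` then gives `ε`.
  obtain ⟨ψ, hψ⟩ := f.definable' (fun M Z => φ.val M.tr Z)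
    (fun _ ε hε => ⟨φ, fun M X _ => by simpa using hε⟩) (Sum.elim r r') (ε / 6) (by positivity)
  have hψ' : ∀ (M : TracialWStarAlgebra.{u}) (X Y : ℕ → M), X ∈ M.dom r → Y ∈ M.dom r' →
      |∑ i : Fin N, norm2 M.tr (f M X i - Y i) - ψ.val M.tr (Sum.elim X Y)| < ε / 6 := by
    intro M X Y hX hY
    have := hψ M (Sum.elim X Y) (by rintro (i | i); exacts [hX i, hY i])
    simpa only [Sum.elim_comp_inl, Sum.elim_comp_inr, hφ] using this
  refine ⟨ψ, ε / 6, by positivity, ?_, fun M X Y Y' hX hY hY' h1 h2 i hi => ?_⟩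
  · rintro _ ⟨μ, hμ, rfl⟩
    obtain ⟨⟨_, M, X, hX, rfl⟩, rfl⟩ := hK hμ
    refine ⟨M, X, f M X, hX, hμ, (f.pushforward_typeOf M X).symm, ?_⟩
    have := hψ' M X (f M X) hX (hf M hX)
    simp only [sub_self, norm2_zero, Finset.sum_const_zero] at this
    linarith [(abs_lt.1 this).1]
  · have hle : ∀ Y : ℕ → M, norm2 M.tr (f M X i - Y i) ≤
        ∑ i : Fin N, norm2 M.tr (f M X i - Y i) := fun Y =>
      Finset.single_le_sum (f := fun i : Fin N => norm2 M.tr (f M X i - Y i))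
        (fun _ _ => norm2_nonneg M _) (Finset.mem_univ ⟨i, hi⟩)
    have h3 := (abs_lt.1 (hψ' M X Y hX hY)).2
    have h4 := (abs_lt.1 (hψ' M X Y' hX hY')).2
    have h5 := norm2_sub_le M (Y i) (f M X i) (Y' i)
    rw [norm2_sub_comm M (Y i) (f M X i)] at h5
    linarith [hle Y, hle Y']

theorem entType_le_of_mem_wstarGen {U : Ultrafilter ℕ} (hU : U ≠ pure 0)
    (M : TracialWStarAlgebra.{u}) {X Y : ℕ → M} (h : ∀ j, Y j ∈ M.wstarGen X) :
    entType U (typeOf M Y) ≤ entType U (typeOf M X) := by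
  -- One radius fitting `X` serves for all `r'`; the realisation `Y` itself need not lie in the
  -- `r'`-balls.
  let r : ℕ → Ioi (0 : ℝ) := fun j => ⟨‖X j‖ + 1, by simp only [mem_Ioi]; positivity⟩
  refine iSup_le fun r' => le_trans ?_ (le_iSup _ r)
  refine entBdd_le_of_formula hU fun N ε hε => ?_
  -- Dividing by `N + 1` makes the sum of `N` errors strictly less than `c = ε / 4`, also when `N =
  -- 0`.
  have hη : 0 < ε / 4 / (N + 1) := by positivity
  choose t ht using fun i => exists_term_norm2_lt M (h i) hη
  let ψ : TrFormula (ℕ ⊕ ℕ) 0 := .conn ⟨fun w : Fin N → ℝ => ∑ i, w i, by fun_prop⟩ fun i =>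
    .dist ((t i).rename (Sum.inl ∘ Sum.inl)) (.var (.inl (.inr i)))
  have hψ : ∀ (M : TracialWStarAlgebra.{u}) (X Y : ℕ → M), ψ.val M.tr (Sum.elim X Y) =
      ∑ i : Fin N, norm2 M.tr ((t i).eval X - Y i) := fun M X Y => by
    simp [ψ, TrFormula.val, TrFormula.eval, TrTerm.eval, TrTerm.eval_rename, ← Function.comp_assoc]
  refine ⟨ψ, ε / 4, by positivity, ?_, fun M X Y Y' hX hY hY' h1 h2 i hi => ?_⟩
  · rintro _ rfl
    refine ⟨M, X, Y, fun j => by simp [r], rfl, rfl, ?_⟩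
    rw [hψ]
    calc _ ≤ ∑ i : Fin N, ε / 4 / (N + 1) := Finset.sum_le_sum fun i _ => (ht i).le
      _ = N / (N + 1) * (ε / 4) := by simp; ring
      _ < 1 * (ε / 4) := by
        gcongr
        rw [div_lt_one (by positivity)]
        exact lt_add_one _
      _ = _ := one_mul _
  · rw [hψ] at h1 h2
    have hle : ∀ Y : ℕ → M, norm2 M.tr ((t i).eval X - Y i) ≤
        ∑ i : Fin N, norm2 M.tr ((t i).eval X - Y i) := fun Y =>
      Finset.single_le_sum (f := fun i : Fin N => norm2 M.tr ((t i).eval X - Y i))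
        (fun _ _ => norm2_nonneg M _) (Finset.mem_univ ⟨i, hi⟩)
    have h5 := norm2_sub_le M (Y i) ((t i).eval X) (Y' i)
    rw [norm2_sub_comm M (Y i) ((t i).eval X)] at h5
    linarith [hle Y, hle Y']

end Monotonicity

end

end TrEnt

open TrEnt
/-- Monotonicity of the covering entropy under push-forward by definable functions, and invariance
of the covering entropy of a type under change of generators. -/
theorem mainTheorem8 (U : Ultrafilter ℕ) (hU : ∀ n : ℕ, U ≠ pure n) :
    (∀ (f : DefinableFunction.{u}) (r r' : ℕ → Ioi (0 : ℝ)),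
      (∀ M : TracialWStarAlgebra.{u}, MapsTo (f M) (M.dom r) (M.dom r')) →
      ∀ K : Set TypeSpace.{u}, K ⊆ boundedTypes r → IsClosed K →
        entBdd U r' (f.pushforward '' K) ≤ entBdd U r K) ∧
    (∀ (M : TracialWStarAlgebra.{u}) (X Y : ℕ → M), (∀ j, Y j ∈ M.wstarGen X) →
      entType U (typeOf M Y) ≤ entType U (typeOf M X)) ∧
    (∀ (M : TracialWStarAlgebra.{u}) (X Y : ℕ → M), M.wstarGen X = M.wstarGen Y →
      entType U (typeOf M X) = entType U (typeOf M Y)) := by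
  refine ⟨fun f r r' hf K hK _ => entBdd_pushforward_le (hU 0) f hf hK,
    fun M X Y h => entType_le_of_mem_wstarGen (hU 0) M h, fun M X Y h => le_antisymm ?_ ?_⟩
  · exact entType_le_of_mem_wstarGen (hU 0) M fun j => h ▸ mem_wstarGen M X j
  · exact entType_le_of_mem_wstarGen (hU 0) M fun j => h ▸ mem_wstarGen M Y j
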